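/- Let $\mathcal X$ be a finite nonempty totally ordered universe and $X=(x_1,\dots,x_n)$ a stream of elements of $\mathcal X$. For $x\in\mathcal X$ put $r_{\min}(x)=|\{i:x_i<x\}|$ and $r_{\max}(x)=|\{i:x_i\le x\}|$; $x$ is an $\alpha$-approximate $q$-quantile of $X$ if $[r_{\min}(x),r_{\max}(x)]\cap[\lceil qn\rceil-\alpha n,\lceil qn\rceil+\alpha n]\neq\emptyset$. A randomized algorithm is $\epsilon$-differentially private if for any two streams of the same length $n$ whose multisets differ by replacing at most one element (in particular, streams that differ in one position) and every set $A$ of outputs, the probability of an output in $A$ on the first stream is at most $e^\epsilon$ times that on the second. **The algorithm.** For $\epsilon>0$, $\alpha>0$, $q\in[0,1]$, Algorithm DPExpGKGumb reads $X$ into a Greenwald–Khanna sketch $S(X)=((v_i,g_i,\Delta_i))_{i=1}^s$ with parameter $\alpha$. The sketch starts empty. After $m$ elements have been read, the next element $x$ is processed as follows. If $m+1$ is divisible by $\lceil 1/(2\alpha)\rceil$ and $m\ge 1/(2\alpha)$, the sketch is first compressed: with $p=\lfloor 2\alpha m\rfloor$, let $\mathrm{band}(\Delta)$ be the least integer $a\ge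 0$ with $p-2^a-(p \bmod 2^a)<\Delta$; scanning from right to left, a tuple $t_i$ (other than the first one, which is never deleted) is deleted together with its descendants, i.e. the maximal contiguous run immediately to its left of tuples of strictly smaller band, and the sum $g_i^*$ of all their $g$-values is added to $g_{i+1}$, whenever $\mathrm{band}(\Delta_i)\le\mathrm{band}(\Delta_{i+1})$ and $g_i^*+g_{i+1}+\Delta_{i+1}<2\alpha m$. Then a tuple with value $x$ is inserted after all tuples of value at most $x$; it is $(x,1,0)$ if it becomes the first or the last tuple and $(x,1,\lfloor 2\alpha m\rfloor)$ otherwise. From the final sketch set $$\hat r_{\min}(x)=\max\Big\{\sum_{j\le i}g_j: v_i<x\Big\},\qquad \hat r_{\max}(x)=\min\Big\{\Delta_i+\sum_{j\le i}g_j: v_i>x\Big\},$$ where the sketch is extended by sentinels at $\mp\infty$ with rank intervals $[0,0]$ and $[n+1,n+1]$. The selection phase iterates over the distinct values $v$ in the sketch (set $B=\{v\}$) and over the nonempty open intervals of $\mathcal X$ between consecutive sketch values or sentinels (set $B$ the interval). On each such $B$ the algorithm computes an interval $[\hat r_{\min},\hat r_{\max}]$ of rank estimates from the sketch, which is the interval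 $[\hat r_{\min}(x),\hat r_{\max}(x)]$ of every $x\in B$. It computes the noisy score $\log|B|-\frac{\epsilon}{2(4\alpha n+2)}\,d(\lceil qn\rceil,[\hat r_{\min},\hat r_{\max}])+Z_B$ with independent standard Gumbel variables $Z_B$, remembers only the best $B$ and its score, and finally outputs a uniformly random element $\hat x$ of the best $B$. Space is the maximal number of words held in memory during the run, for every outcome of the random variables; a word holds an element of $\mathcal X$, a counter or a real number. **Theorem.** For all $\epsilon>0$, $\alpha>0$ and $q\in[0,1]$, Algorithm DPExpGKGumb is $\epsilon$-differentially private (and its output law is a probability distribution on $\mathcal X$). Moreover there is an absolute constant $C>0$ such that the following hold for all $\epsilon>0$, $0<\alpha\le 1$, $0<\beta\le1$. 1. For every $q\in[0,1]$, every $n$ and every stream of length $n$, the algorithm with sketch parameter $\alpha$ uses space at most $C\cdot\frac1\alpha\max\{1,\log(\alpha n)\}$ (where $\log 0$ is read as $0$), and with probability at least $1-\beta$ $$d\big(\lceil qn\rceil,[\hat r_{\min}(\hat x),\hat r_{\max}(\hat x)]\big)\le 2\alpha n+\frac{2(4\alpha n+2)\log(|\mathcal X|/\beta)}{\epsilon}.$$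 2. Suppose $|\mathcal X|\ge2$. There is a sketch parameter $a\in(0,1]$, depending only on $\alpha,\beta,\epsilon,\mathcal X$, such that for every $q\in[0,1]$, every $n$ with $n>\frac{12\log(|\mathcal X|/\beta)}{\alpha\epsilon}$ and $\alpha n\ge1$, and every stream of length $n$, the algorithm run with $a$ in place of $\alpha$ uses space at most $$C\cdot\frac{\log(|\mathcal X|/\beta)\,\log(\alpha\epsilon n)}{\alpha\min\{\epsilon,1\}},$$ and with probability at least $1-\beta$ its output $\hat x$ is an $\alpha$-approximate $q$-quantile of $X$. -/

import Mathlib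

noncomputable section

namespace DPQuantile

open MeasureTheory

universe u

/-! ## Ranks, approximate quantiles, neighbouring data sets -/

section Basics

variable {𝒳 : Type u} [LinearOrder 𝒳] {n : ℕ}

/-- `r_min(x)`: the number of stream elements strictly below `x`. -/
def rankMin (X : Fin n → 𝒳) (x : 𝒳) : ℕ :=
  (Finset.univ.filter fun i => X i < x).card

/-- `r_max(x)`: the number of stream elements that are at most `x`. -/
def rankMax (X : Fin n → 𝒳) (x : 𝒳) : ℕ :=
  (Finset.univ.filter fun i => X i ≤ x).card

/-- The target rank `⌈q n⌉`, as a real number. -/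
def targetRank (q : ℝ) (n : ℕ) : ℝ := (⌈q * (n : ℝ)⌉ : ℝ)

/-- `x` is an `α`-approximate `q`-quantile of `X`: its rank interval meets
`[⌈qn⌉ - αn, ⌈qn⌉ + αn]`. -/
def IsApproxQuantile (α q : ℝ) (X : Fin n → 𝒳) (x : 𝒳) : Prop :=
  (Set.Icc (rankMin X x : ℝ) (rankMax X x : ℝ) ∩
    Set.Icc (targetRank q n - α * n) (targetRank q n + α * n)).Nonempty

/-- Neighbouring data sets (swap model): as multisets, `X'` arises from `X` by replacing at most
one element. In particular this holds when the streams differ in at most one position. -/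
def Neighboring (X X' : Fin n → 𝒳) : Prop :=
  ∃ σ : Equiv.Perm (Fin n), hammingDist (X ∘ σ) X' ≤ 1

/-- (Pure) `ε`-differential privacy of a randomized mechanism on streams of length `n`, given by
its output law on every input. -/
def IsDifferentiallyPrivate [MeasurableSpace 𝒳] (ε : ℝ) (M : (Fin n → 𝒳) → Measure 𝒳) : Prop :=
  ∀ X X' : Fin n → 𝒳, Neighboring X X' → ∀ A : Set 𝒳, MeasurableSet A →
    M X A ≤ ENNReal.ofReal (Real.exp ε) * M X' A

end Basics

/-! ## The Greenwald–Khanna sketch -/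

/-- A tuple `(v, g, Δ)` of the sketch. -/
structure GKTuple (𝒳 : Type u) where
  val : 𝒳
  g : ℕ
  Δ : ℕ

theorem exists_band (p d : ℕ) : ∃ a : ℕ, p < d + 2 ^ a + p % 2 ^ a :=
  ⟨p, by have := Nat.lt_two_pow_self (n := p); omega⟩

/-- The band of a value `Δ ≤ p`, where `p = ⌊2αn⌋`: band `0` is `{p}`, and for `a ≥ 1` band `a`
consists of the `Δ` with `p - 2^a - (p mod 2^a) < Δ ≤ p - 2^(a-1) - (p mod 2^(a-1))`. As the lower
ends decrease with `a`, the band is the least `a` with `p - 2^a - (p mod 2^a) < Δ`. -/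
def band (p d : ℕ) : ℕ := Nat.find (exists_band p d)

section Sketch

variable {𝒳 : Type u}

/-- The right-to-left scan of the compress operation at a time when `n` elements have been seen.
`cur` is the tuple `t_{i+1}`, the list holds the tuples to its left, nearest first, and the result
is in the same (reversed) order. The descendants of a tuple `t` form the maximal contiguous run
immediately to its left of tuples whose band is strictly smaller than that of `t`. The leftmost
tuple, which holds the minimum of the stream, is never deleted. -/
def compressScan (α : ℝ) (n : ℕ) (cur : GKTuple 𝒳) : List (GKTuple 𝒳) → List (GKTuple 𝒳)
  | [] => [cur]
  | [t] => [cur, t]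
  | t :: t' :: rest =>
    let p := ⌊2 * α * (n : ℝ)⌋₊
    let isDesc : GKTuple 𝒳 → Bool := fun r => decide (band p r.Δ < band p t.Δ)
    let gStar := t.g + (((t' :: rest).takeWhile isDesc).map GKTuple.g).sum
    if band p t.Δ ≤ band p cur.Δ ∧ ((gStar + cur.g + cur.Δ : ℕ) : ℝ) < 2 * α * n then
      compressScan α n { cur with g := gStar + cur.g } ((t' :: rest).dropWhile isDesc)
    else
      cur :: compressScan α n t (t' :: rest)
  termination_by l => l.length
  decreasing_by
    · exact Nat.lt_succ_of_le (List.dropWhile_suffix (l := t' :: rest) isDesc).length_le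
    · simp

/-- The compress operation of the Greenwald–Khanna sketch. -/
def compress (α : ℝ) (n : ℕ) (S : List (GKTuple 𝒳)) : List (GKTuple 𝒳) :=
  if (n : ℝ) < 1 / (2 * α) then S
  else
    match S.reverse with
    | [] => []
    | t :: rest => (compressScan α n t rest).reverse

variable [LinearOrder 𝒳]

/-- The insert operation, when `n` elements have been seen before `x`. The new tuple is placed
before the first tuple of larger value; it is `(x, 1, 0)` if it becomes the first or the last one,
and `(x, 1, ⌊2αn⌋)` otherwise. -/
def insert (α : ℝ) (n : ℕ) (x : 𝒳) (S : List (GKTuple 𝒳)) : List (GKTuple 𝒳) :=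
  let l := S.takeWhile fun t => decide (t.val ≤ x)
  let r := S.dropWhile fun t => decide (t.val ≤ x)
  l ++ ⟨x, 1, if l.isEmpty || r.isEmpty then 0 else ⌊2 * α * (n : ℝ)⌋₊⟩ :: r

/-- Processing one more stream element when `n` have been seen before: the sketch is compressed
once in `⌈1/(2α)⌉` insertions. -/
def update (α : ℝ) (n : ℕ) (x : 𝒳) (S : List (GKTuple 𝒳)) : List (GKTuple 𝒳) :=
  insert α n x (if (n + 1) % ⌈1 / (2 * α)⌉₊ = 0 then compress α n S else S)

/-! ### Rank estimates derived from a sketch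

Tuples are indexed from `0`. A sketch is tacitly extended by a sentinel at `-∞` with rank interval
`[0, 0]` and a sentinel at `+∞` with rank interval `[n + 1, n + 1]`, `n` being the sum of all `g`.
-/

/-- The sum of the `g`-values of the first `k` tuples. -/
def prefixG (S : List (GKTuple 𝒳)) (k : ℕ) : ℕ := ((S.take k).map GKTuple.g).sum

/-- The upper confidence bound `Δ_i + ∑_{j ≤ i} g_j` of a tuple. -/
def upper (S : List (GKTuple 𝒳)) (i : Fin S.length) : ℕ := (S.get i).Δ + prefixG S (i + 1)

/-- The least upper confidence bound among the tuples in `I` and the sentinel at `+∞`. -/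
def minUpper (S : List (GKTuple 𝒳)) (I : Finset (Fin S.length)) : ℕ :=
  (Insert.insert (prefixG S S.length + 1) (I.image (upper S))).min' (Finset.insert_nonempty _ _)

/-- `r̂_min(x) = max {∑_{j ≤ i} g_j : v_i < x}` (`0` from the sentinel at `-∞`). -/
def rHatMin (S : List (GKTuple 𝒳)) (x : 𝒳) : ℕ :=
  (Finset.univ.filter fun i : Fin S.length => (S.get i).val < x).sup fun i => prefixG S (i + 1)

/-- `r̂_max(x) = min {Δ_i + ∑_{j ≤ i} g_j : v_i > x}`. -/
def rHatMax (S : List (GKTuple 𝒳)) (x : 𝒳) : ℕ :=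
  minUpper S (Finset.univ.filter fun i : Fin S.length => x < (S.get i).val)

/-- The distance of a real number to the interval `[a, b]`. -/
def distToInterval (r : ℝ) (a b : ℕ) : ℝ := Metric.infDist r (Set.Icc (a : ℝ) (b : ℝ))

end Sketch

/-! ## The algorithm -/

/-- The standard Gumbel distribution `Gumb(0, 1)`, of density `exp (-(z + exp (-z)))`. -/
def gumbel : Measure ℝ :=
  volume.withDensity fun z => ENNReal.ofReal (Real.exp (-(z + Real.exp (-z))))

/-- The memory of the algorithm: everything it remembers between two elementary steps (reading a
stream element, or one iteration of the selection loops). -/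
structure Memory (𝒳 : Type u) where
  sketch : List (GKTuple 𝒳)
  /-- number of stream elements read -/
  n : ℕ
  /-- loop counter of the selection phase -/
  i : ℕ
  rMin : ℕ
  rMax : ℕ
  /-- the current utility -/
  util : ℝ
  /-- the current noisy score -/
  score : ℝ
  /-- loop index of the best noisy score so far -/
  maxIndex : Option ℕ
  /-- the best noisy score so far (`⊥` is `-∞`) -/
  maxValue : WithBot ℝ

section Algorithm

variable {𝒳 : Type u}

/-- Size of the memory in words, a word holding a universe element, a counter or a real number:
three words for every tuple, and sixteen words for the eight registers of `Memory` and for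
the scratch variables of the elementary steps. -/
def Memory.words (m : Memory 𝒳) : ℕ := 3 * m.sketch.length + 16

/-- The memory at the start. -/
def Memory.init : Memory 𝒳 := ⟨[], 0, 0, 0, 0, 0, 0, none, ⊥⟩

variable [LinearOrder 𝒳]

/-- Reading one stream element. -/
def readStep (α : ℝ) (m : Memory 𝒳) (x : 𝒳) : Memory 𝒳 :=
  { m with sketch := update α m.n x m.sketch, n := m.n + 1 }

/-- The memory after the stream has been read. -/
def afterStream {n : ℕ} (α : ℝ) (X : Fin n → 𝒳) : Memory 𝒳 :=
  (List.ofFn X).foldl (readStep α) Memory.init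

/-- The sketch `S(X)`. -/
def sketchOf {n : ℕ} (α : ℝ) (X : Fin n → 𝒳) : List (GKTuple 𝒳) := (afterStream α X).sketch

/-- Lower rank bound computed in iteration `c` of the selection phase. With `s` tuples, iteration
`c < s` treats the value of tuple `c`, and iteration `s + k` (`0 ≤ k ≤ s`) treats the open interval
between tuple `k - 1` and tuple `k`. -/
def iterMin (S : List (GKTuple 𝒳)) (c : ℕ) : ℕ :=
  if c < S.length then prefixG S c else prefixG S (c - S.length)

/-- Upper rank bound computed in iteration `c` of the selection phase. -/
def iterMax (S : List (GKTuple 𝒳)) (c : ℕ) : ℕ :=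
  if h : c < S.length then
    minUpper S (Finset.univ.filter fun j => (S.get ⟨c, h⟩).val < (S.get j).val)
  else minUpper S (Finset.univ.filter fun j => c - S.length ≤ (j : ℕ))

variable [Fintype 𝒳]

/-- The universe elements strictly between tuple `k - 1` and tuple `k`. -/
def gap (S : List (GKTuple 𝒳)) (k : ℕ) : Finset 𝒳 :=
  Finset.univ.filter fun x =>
    (∀ j : Fin S.length, (j : ℕ) + 1 = k → (S.get j).val < x) ∧
    (∀ j : Fin S.length, (j : ℕ) = k → x < (S.get j).val)

/-- The set of universe elements that iteration `c` of the selection phase stands for; it is empty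
if the iteration is skipped, which happens for repeated tuple values and for empty intervals. -/
def cell (S : List (GKTuple 𝒳)) (c : ℕ) : Finset 𝒳 :=
  if h : c < S.length then
    if ∀ j : Fin S.length, (j : ℕ) < c → (S.get j).val ≠ (S.get ⟨c, h⟩).val then
      {(S.get ⟨c, h⟩).val}
    else ∅
  else gap S (c - S.length)

/-- One iteration of the selection phase, with a Gumbel variable `z`. The sensitivity `Δ_u` of the
utility is taken to be `4αn + 2`. -/
def selectStep (ε α q : ℝ) (m : Memory 𝒳) (z : ℝ) : Memory 𝒳 :=
  if (cell m.sketch m.i).Nonempty then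
    let rMin := iterMin m.sketch m.i
    let rMax := iterMax m.sketch m.i
    let util := -distToInterval (targetRank q m.n) rMin rMax
    let score := Real.log ((cell m.sketch m.i).card : ℝ)
      + ε / (2 * (4 * α * m.n + 2)) * util + z
    { m with
      i := m.i + 1
      rMin := rMin
      rMax := rMax
      util := util
      score := score
      maxIndex := if m.maxValue < (score : WithBot ℝ) then some m.i else m.maxIndex
      maxValue := if m.maxValue < (score : WithBot ℝ) then (score : WithBot ℝ) else m.maxValue }
  else { m with i := m.i + 1 }

/-- The number of iterations of the selection phase. -/
def numIter {n : ℕ} (α : ℝ) (X : Fin n → 𝒳) : ℕ := 2 * (sketchOf α X).length + 1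

/-- The output law for a given final memory: uniform on the selected cell. -/
def output [MeasurableSpace 𝒳] (m : Memory 𝒳) : Measure 𝒳 :=
  match m.maxIndex with
  | some c => ProbabilityTheory.uniformOn (cell m.sketch c : Set 𝒳)
  | none => 0

/-- The law of the output of the algorithm with privacy parameter `ε`, sketch parameter `α` and
target quantile `q` on the stream `X`: independent standard Gumbel variables are used in the
iterations of the selection phase, then an element of the selected cell is drawn uniformly. -/
def dpExpGKGumb {n : ℕ} [MeasurableSpace 𝒳] (ε α q : ℝ) (X : Fin n → 𝒳) : Measure 𝒳 :=
  (Measure.pi fun _ : Fin (numIter α X) => gumbel).bind fun z =>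
    output ((List.ofFn z).foldl (selectStep ε α q) (afterStream α X))

/-- All memory contents during the run of the algorithm on the stream `X` with noise `z`. -/
def memoryTrace {n : ℕ} (ε α q : ℝ) (X : Fin n → 𝒳) (z : Fin (numIter α X) → ℝ) :
    List (Memory 𝒳) :=
  (List.ofFn X).scanl (readStep α) Memory.init ++
    (List.ofFn z).scanl (selectStep ε α q) (afterStream α X)

/-- The algorithm with these parameters uses at most `B` words of memory on the stream `X`, at all
times and whatever the values of the Gumbel variables are. -/
def UsesSpaceAtMost {n : ℕ} (ε α q : ℝ) (X : Fin n → 𝒳) (B : ℝ) : Prop :=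
  ∀ z : Fin (numIter α X) → ℝ, ∀ m ∈ memoryTrace ε α q X z, (m.words : ℝ) ≤ B

end Algorithm

end DPQuantile

end

open MeasureTheory

namespace DPQuantile

universe u

/-! ## Bands -/

/-! Privacy and accuracy depend on the sketch only through its rank estimates. By the Gumbel-max
trick (`pi_gumbel_argmaxEvent`) a cell `B` wins with probability proportional to `|B| * exp (κ *
u)`, where `κ = ε / (2 * (4αn + 2))` and `u` is its utility. The cells partition the universe and
`u` is constant on each, so the uniform draw inside the winner yields the exponential mechanism on
single elements (`dpExpGKGumb_singleton`).

For privacy no relation between the sketches of neighbouring streams is needed. The invariant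
`RankInv` puts `rHatMin` within `⌊2αn⌋` below the true rank and `rHatMax` between 1 and `⌊2αn⌋ + 1`
above it. True ranks move by at most 1 between neighbours, so estimates, and hence the utility, move
by at most `2αn + 1` (`utility_le_of_neighboring`). For accuracy, some element has utility 0, so the
normalising sum is at least 1 and a union bound over the universe suffices (`le_dpExpGKGumb_real`).
Converting estimated into true ranks gives approximate quantiles
(`isApproxQuantile_of_distToInterval_le`).

The hard part is the size of the Greenwald–Khanna sketch. Each tuple is annotated with the initial
`Δ`-values of the elements merged into it. Band comparisons persist in time, so merged elements
always lie in bands at most that of their tuple. When a compressed sketch keeps a tuple of band `a`,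
the refused merge forces about `2^(a-1)` elements of band at most `a` nearby. This remains true when
the right neighbour has a larger band and is heavy with old elements: `LowBounded` remembers how
heavy it was with old elements when the left tuple was inserted (`le_of_isCompressed`). Charging
every element at most twice (`countP_band_mul_le`), and using that at most `2^a / α` elements have
band at most `a` (`bandMass_merged_le`), leaves `O(1/α)` tuples in each of the `O(log (αn))` bands.
-/

theorem band_le_iff {p d a : ℕ} : band p d ≤ a ↔ p < d + 2 ^ a + p % 2 ^ a := by
  refine ⟨fun h => ?_, fun h => Nat.find_min' _ h⟩
  have key : ∀ b, p < d + 2 ^ b + p % 2 ^ b → p < d + 2 ^ (b + 1) + p % 2 ^ (b + 1) := by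
    intro b hb
    have h1 : p % 2 ^ (b + 1) % 2 ^ b = p % 2 ^ b :=
      Nat.mod_mod_of_dvd p (pow_dvd_pow 2 (Nat.le_succ b))
    have h2 := Nat.mod_le (p % 2 ^ (b + 1)) (2 ^ b)
    have h3 : (2 : ℕ) ^ (b + 1) = 2 * 2 ^ b := by ring
    omega
  have hs : p < d + 2 ^ band p d + p % 2 ^ band p d := Nat.find_spec (exists_band p d)
  exact Nat.le_induction hs (fun b _ hb => key b hb) a h

/-- The thresholds that separate bands at time `p`. The thresholds at a later time are thresholds
at all earlier times. -/
def IsThreshold (p T : ℕ) : Prop := ∃ a : ℕ, 2 ^ a ∣ T ∧ p < T + 2 * 2 ^ a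

/-- The definition omits the inequality `T + 2 ^ a ≤ p` satisfied by the actual lower end of band
`a`. What remains is inherited by smaller `p`, and this makes `BandLE` persist as the stream grows.
-/
theorem IsThreshold.anti {p p' T : ℕ} (hp : p ≤ p') (h : IsThreshold p' T) : IsThreshold p T := by
  obtain ⟨a, h1, h2⟩ := h
  exact ⟨a, h1, hp.trans_lt h2⟩

/-- `d` lies in a band that is at most the band of `d'`, now and later. -/
def BandLE (p d d' : ℕ) : Prop := ∀ T, IsThreshold p T → T < d' → T < d

theorem BandLE.mono {p p' d d' : ℕ} (hp : p ≤ p') (h : BandLE p d d') : BandLE p' d d' :=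
  fun T hT => h T (hT.anti hp)

theorem BandLE.refl (p d : ℕ) : BandLE p d d := fun _ _ h => h

theorem BandLE.trans {p d d' d'' : ℕ} (h : BandLE p d d') (h' : BandLE p d' d'') :
    BandLE p d d'' := fun T hT hd => h T hT (h' T hT hd)

theorem IsThreshold.exists_band {p T : ℕ} (h : IsThreshold p T) (hT : T < p) :
    ∃ a, ∀ d, T < d ↔ band p d ≤ a := by
  classical
  have hex : ∃ a : ℕ, 2 ^ a ∣ T ∧ p < T + 2 * 2 ^ a := h
  obtain ⟨h1, h2⟩ := Nat.find_spec hex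
  set a := Nat.find hex with ha
  -- Minimality of `a`: otherwise `a - 1` would already be a witness. With both inequalities, `T` is
  -- exactly `p - 2^a - p % 2^a`.
  have h3 : T + 2 ^ a ≤ p := by
    by_contra hcon
    rcases Nat.eq_zero_or_pos a with h0 | h0
    · rw [h0] at hcon; omega
    · obtain ⟨b, hb⟩ : ∃ b, a = b + 1 := ⟨a - 1, by omega⟩
      have : 2 ^ b ∣ T ∧ p < T + 2 * 2 ^ b := by
        rw [hb] at h1 hcon
        refine ⟨(pow_dvd_pow 2 (Nat.le_succ b)).trans h1, ?_⟩
        have : (2 : ℕ) ^ (b + 1) = 2 * 2 ^ b := by ring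
        omega
      have := Nat.find_min' hex this
      omega
  refine ⟨a, fun d => ?_⟩
  rw [band_le_iff]
  have h4 : p % 2 ^ a = p - (T + 2 ^ a) := by
    have h5 : p = (p - (T + 2 ^ a)) + (T + 2 ^ a) := by omega
    have h6 : 2 ^ a ∣ T + 2 ^ a := dvd_add h1 dvd_rfl
    obtain ⟨k, hk⟩ := h6
    conv_lhs => rw [h5, hk]
    rw [Nat.add_mul_mod_self_left, ← hk]
    exact Nat.mod_eq_of_lt (by omega)
  omega

/-- Every threshold below `p` is the lower end of a current band, so a comparison of bands made at
one time separates `d` from `d'` correctly at all later times too. -/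
theorem bandLE_of_band_le {p d d' : ℕ} (hd' : d' ≤ p) (h : band p d ≤ band p d') :
    BandLE p d d' := by
  intro T hT hlt
  obtain ⟨a, ha⟩ := hT.exists_band (by omega)
  exact (ha d).2 (h.trans ((ha d').1 hlt))

theorem band_le_of_lt {p d a : ℕ} (h : p < 2 ^ a) : band p d ≤ a := by
  rw [band_le_iff]; omega

/-- The lower end of band `a`. -/
theorem exists_isThreshold {p a : ℕ} (h : 2 ^ a ≤ p) :
    ∃ T, IsThreshold p T ∧ T < p ∧ p < T + 2 * 2 ^ a ∧ ∀ d, band p d ≤ a ↔ T < d := by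
  have h1 := Nat.mod_lt p (show 0 < 2 ^ a by positivity)
  have h2 := Nat.div_add_mod p (2 ^ a)
  have h3 : 1 ≤ p / 2 ^ a := (Nat.one_le_div_iff (by positivity)).2 h
  obtain ⟨k, hk⟩ : ∃ k, p / 2 ^ a = k + 1 := ⟨p / 2 ^ a - 1, by omega⟩
  rw [hk] at h2
  have h4 : 2 ^ a * (k + 1) = 2 ^ a * k + 2 ^ a := by ring
  have h5 : 0 < 2 ^ a := by positivity
  refine ⟨2 ^ a * k, ⟨a, dvd_mul_right _ _, by omega⟩, by omega, by omega, fun d => ?_⟩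
  rw [band_le_iff]
  omega

theorem BandLE.band_le {p d d' a : ℕ} (h : BandLE p d d') (h' : band p d' ≤ a) :
    band p d ≤ a := by
  by_cases hp : 2 ^ a ≤ p
  · obtain ⟨T, hT, -, -, hiff⟩ := exists_isThreshold hp
    exact (hiff d).2 (h T hT ((hiff d').1 h'))
  · exact band_le_of_lt (by omega)

/-- The band decreases in `Δ`, so `Δ = 0` has the largest one. Hence the first tuple of a sketch is
never a descendant. -/
theorem band_zero_le_imp {p d : ℕ} (h : band p 0 < band p d) : False := by
  have h1 : band p d ≤ band p 0 := by
    rw [band_le_iff]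
    have := (band_le_iff (p := p) (d := 0)).1 le_rfl
    omega
  omega

/-- A `Δ` in band `a` is at most the lower end of band `a - 1`. -/
theorem add_le_of_lt_band {p d a : ℕ} (h : a < band p d) : d + 2 ^ a ≤ p := by
  have := mt band_le_iff.2 (not_le.2 h)
  omega

/-! ## The compress operation as a sequence of deletions -/

section Compress

variable {𝒳 : Type u}

/-- The sum of the `g`-values of a list of tuples. -/
def gSum (L : List (GKTuple 𝒳)) : ℕ := (L.map GKTuple.g).sum

@[simp] theorem gSum_nil : gSum ([] : List (GKTuple 𝒳)) = 0 := rfl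

@[simp] theorem gSum_cons (t : GKTuple 𝒳) (L : List (GKTuple 𝒳)) :
    gSum (t :: L) = t.g + gSum L := by simp [gSum]

@[simp] theorem gSum_append (L L' : List (GKTuple 𝒳)) :
    gSum (L ++ L') = gSum L + gSum L' := by simp [gSum]

@[simp] theorem gSum_reverse (L : List (GKTuple 𝒳)) : gSum L.reverse = gSum L := by
  simp [gSum, List.sum_reverse]

/-- The deletion of the tuple `t` and its descendants `D`, merged into the tuple `cur`. -/
structure Deletion (α : ℝ) (m : ℕ) (L D : List (GKTuple 𝒳)) (t cur : GKTuple 𝒳) : Prop where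
  not_first : L ++ D ≠ []
  band_le : band ⌊2 * α * (m : ℝ)⌋₊ t.Δ ≤ band ⌊2 * α * (m : ℝ)⌋₊ cur.Δ
  small : t.g + gSum D + cur.g + cur.Δ ≤ ⌊2 * α * (m : ℝ)⌋₊
  desc : ∀ r ∈ D, band ⌊2 * α * (m : ℝ)⌋₊ r.Δ < band ⌊2 * α * (m : ℝ)⌋₊ t.Δ
  maximal : ∀ L₀ w, L = L₀ ++ [w] →
    band ⌊2 * α * (m : ℝ)⌋₊ t.Δ ≤ band ⌊2 * α * (m : ℝ)⌋₊ w.Δ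

/-- `R` is the part of the sketch already settled by the scan. Carrying it along turns the scan into
a chain of single deletions in the full sketch, so an invariant has to be checked for one deletion
only. -/
theorem compressScan_induction {α : ℝ} {m : ℕ} {P : List (GKTuple 𝒳) → Prop}
    (hstep : ∀ L D t cur R, Deletion α m L D t cur → P (L ++ (D ++ t :: cur :: R)) →
      P (L ++ { cur with g := t.g + gSum D + cur.g } :: R))
    (cur : GKTuple 𝒳) (rest R : List (GKTuple 𝒳)) (h : P (rest.reverse ++ cur :: R)) :
    P ((compressScan α m cur rest).reverse ++ R) := by
  induction hn : rest.length using Nat.strong_induction_on generalizing cur rest R with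
  | _ n ih =>
  match rest, h, hn with
  | [], h, _ => simpa [compressScan] using h
  | [t], h, _ => simpa [compressScan] using h
  | t :: t' :: rest, h, hn =>
    rw [compressScan]
    set p := ⌊2 * α * (m : ℝ)⌋₊ with hp
    set isDesc : GKTuple 𝒳 → Bool := fun r => decide (band p r.Δ < band p t.Δ) with hD
    split_ifs with hc
    · refine ih _ ?_ _ _ _ ?_ rfl
      · rw [← hn]
        exact Nat.lt_succ_of_le (List.dropWhile_suffix (l := t' :: rest) isDesc).length_le
      · have hsplit := List.takeWhile_append_dropWhile (p := isDesc) (l := t' :: rest)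
        have hrev : (t' :: rest).reverse = ((t' :: rest).dropWhile isDesc).reverse ++
            ((t' :: rest).takeWhile isDesc).reverse := by
          rw [← List.reverse_append, hsplit]
        have := hstep ((t' :: rest).dropWhile isDesc).reverse
          ((t' :: rest).takeWhile isDesc).reverse t cur R ?_ ?_
        · rw [gSum_reverse] at this
          exact this
        · refine ⟨?_, hc.1, ?_, ?_, ?_⟩
          · rw [← hrev]; simp
          · rw [gSum_reverse]
            exact Nat.le_floor hc.2.le
          · intro r hr
            have := List.mem_takeWhile_imp (List.mem_reverse.1 hr)
            simpa [hD] using this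
          · intro L₀ w hw
            have hw' : (t' :: rest).dropWhile isDesc = w :: L₀.reverse := by
              have := congrArg List.reverse hw
              simpa using this
            have hne : (t' :: rest).dropWhile isDesc ≠ [] := by rw [hw']; simp
            have := List.head_dropWhile_not isDesc hne
            have hh : ((t' :: rest).dropWhile isDesc).head hne = w := by
              simp only [hw', List.head_cons]
            rw [hh] at this
            simpa [hD] using this
        · rw [List.reverse_cons, hrev] at h
          simpa using h
    · rw [List.reverse_cons, List.append_assoc]
      refine ih _ ?_ _ _ _ ?_ rfl
      · rw [← hn]; simp
      · simpa using h

theorem compress_induction {α : ℝ} {m : ℕ} {P : List (GKTuple 𝒳) → Prop}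
    (hstep : ∀ L D t cur R, Deletion α m L D t cur → P (L ++ (D ++ t :: cur :: R)) →
      P (L ++ { cur with g := t.g + gSum D + cur.g } :: R))
    (S : List (GKTuple 𝒳)) (h : P S) : P (compress α m S) := by
  unfold compress
  split_ifs
  · exact h
  · cases hS : S.reverse with
    | nil => simpa [List.reverse_eq_nil_iff.1 hS] using h
    | cons t rest =>
      have := compressScan_induction hstep t rest [] (by
        rw [← List.reverse_reverse S, hS] at h; simpa using h)
      simpa using this

/-- The sum of the `g`-values of the maximal run of tuples of band less than `b` at the beginning
of a list. -/
def runSum (p b : ℕ) (L : List (GKTuple 𝒳)) : ℕ :=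
  gSum (L.takeWhile fun r => decide (band p r.Δ < b))

@[simp] theorem runSum_nil (p b : ℕ) : runSum p b ([] : List (GKTuple 𝒳)) = 0 := rfl

theorem runSum_cons (p b : ℕ) (t : GKTuple 𝒳) (L : List (GKTuple 𝒳)) :
    runSum p b (t :: L) = if band p t.Δ < b then t.g + runSum p b L else 0 := by
  unfold runSum
  by_cases h : band p t.Δ < b <;> simp [h]

theorem runSum_append_le (p b : ℕ) (L L' : List (GKTuple 𝒳)) :
    runSum p b (L ++ L') ≤ gSum L + runSum p b L' := by
  induction L with
  | nil => simp
  | cons t L ih =>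
    rw [List.cons_append, runSum_cons, gSum_cons]
    split_ifs <;> omega

/-- In a compressed sketch (in reversed order) no tuple but the first can be deleted. -/
def IsCompressed (p m : ℕ) : List (GKTuple 𝒳) → Prop
  | cur :: t :: t' :: rest =>
    (band p t.Δ ≤ band p cur.Δ →
      m ≤ t.g + runSum p (band p t.Δ) (t' :: rest) + cur.g + cur.Δ) ∧
    IsCompressed p m (t :: t' :: rest)
  | _ => True

/-- A merge moves `g`-weight to the right, out of a run and into the tuple that absorbs it, and
preserves the `Δ` of the latter. So the weight of `cur` together with any low-band run on its left
cannot drop during the rest of the scan. -/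
theorem compressScan_head {α : ℝ} {m : ℕ} (b : ℕ) (cur : GKTuple 𝒳)
    (rest : List (GKTuple 𝒳)) :
    ∃ cur' O, compressScan α m cur rest = cur' :: O ∧ cur'.Δ = cur.Δ ∧
      cur.g + runSum ⌊2 * α * (m : ℝ)⌋₊ b rest ≤ cur'.g + runSum ⌊2 * α * (m : ℝ)⌋₊ b O := by
  induction hn : rest.length using Nat.strong_induction_on generalizing cur rest with
  | _ n ih =>
  match rest, hn with
  | [], _ => exact ⟨cur, [], by simp [compressScan], rfl, le_rfl⟩
  | [t], _ => exact ⟨cur, [t], by simp [compressScan], rfl, le_rfl⟩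
  | t :: t' :: rest, hn =>
    rw [compressScan]
    set p := ⌊2 * α * (m : ℝ)⌋₊ with hp
    set isDesc : GKTuple 𝒳 → Bool := fun r => decide (band p r.Δ < band p t.Δ) with hD
    have hsplit := List.takeWhile_append_dropWhile (p := isDesc) (l := t' :: rest)
    split_ifs with hc
    · obtain ⟨cur', O, h1, h2, h3⟩ := ih _ (by
        rw [← hn]
        exact Nat.lt_succ_of_le (List.dropWhile_suffix (l := t' :: rest) isDesc).length_le)
        { cur with g := t.g + (((t' :: rest).takeWhile isDesc).map GKTuple.g).sum + cur.g }
        ((t' :: rest).dropWhile isDesc) rfl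
      refine ⟨cur', O, h1, h2, le_trans ?_ h3⟩
      have h4 := runSum_append_le p b ((t' :: rest).takeWhile isDesc)
        ((t' :: rest).dropWhile isDesc)
      rw [hsplit] at h4
      have h5 : gSum ((t' :: rest).takeWhile isDesc) =
        (((t' :: rest).takeWhile isDesc).map GKTuple.g).sum := rfl
      rw [runSum_cons]
      simp only
      split_ifs <;> omega
    · obtain ⟨t₁, O, h1, h2, h3⟩ := ih _ (by rw [← hn]; simp) t (t' :: rest) rfl
      refine ⟨cur, t₁ :: O, by rw [h1], rfl, ?_⟩
      rw [runSum_cons, runSum_cons p b t₁, h2]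
      split_ifs <;> omega

theorem isCompressed_compressScan {α : ℝ} {m : ℕ} (cur : GKTuple 𝒳)
    (rest : List (GKTuple 𝒳)) :
    IsCompressed ⌊2 * α * (m : ℝ)⌋₊ ⌈2 * α * (m : ℝ)⌉₊ (compressScan α m cur rest) := by
  induction hn : rest.length using Nat.strong_induction_on generalizing cur rest with
  | _ n ih =>
  match rest, hn with
  | [], _ => simp [compressScan, IsCompressed]
  | [t], _ => simp [compressScan, IsCompressed]
  | t :: t' :: rest, hn =>
    rw [compressScan]
    set p := ⌊2 * α * (m : ℝ)⌋₊ with hp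
    set isDesc : GKTuple 𝒳 → Bool := fun r => decide (band p r.Δ < band p t.Δ) with hD
    split_ifs with hc
    · refine ih _ ?_ _ _ rfl
      rw [← hn]
      exact Nat.lt_succ_of_le (List.dropWhile_suffix (l := t' :: rest) isDesc).length_le
    -- The refused merge concerns the list before the scan moves on, but the claim concerns the
    -- final list. `compressScan_head` for the band of `t` transfers the lower bound.
    · have hI := ih _ (by rw [← hn]; simp) t (t' :: rest) rfl
      obtain ⟨t₁, O, h1, h2, h3⟩ := compressScan_head (α := α) (m := m) (band p t.Δ) t (t' :: rest)
      rw [h1] at hI ⊢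
      match O, hI, h3 with
      | [], _, _ => simp [IsCompressed]
      | o :: O, hI, h3 =>
        refine ⟨fun hb => ?_, hI⟩
        rw [← hp] at h3
        rw [h2] at hb ⊢
        have h4 : ¬ ((_ : ℝ) < 2 * α * m) := fun h => hc ⟨hb, h⟩
        rw [not_lt] at h4
        have h5 := Nat.ceil_le.2 h4
        have h6 : runSum p (band p t.Δ) (t' :: rest) =
          (((t' :: rest).takeWhile isDesc).map GKTuple.g).sum := rfl
        omega

theorem isCompressed_compress {α : ℝ} {m : ℕ} {S : List (GKTuple 𝒳)}
    (h : 1 / (2 * α) ≤ (m : ℝ)) :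
    IsCompressed ⌊2 * α * (m : ℝ)⌋₊ ⌈2 * α * (m : ℝ)⌉₊ (compress α m S).reverse := by
  unfold compress
  rw [if_neg (not_lt.2 h)]
  cases S.reverse with
  | nil => simp [IsCompressed]
  | cons t rest => simpa using isCompressed_compressScan t rest

end Compress

/-! ## Rank invariants of the sketch -/

section Ranks

variable {𝒳 : Type u} [LinearOrder 𝒳]

/-- The memory after the elements of a list have been read. -/
noncomputable def readAll (α : ℝ) (xs : List 𝒳) : Memory 𝒳 := xs.foldl (readStep α) Memory.init

theorem readAll_append_singleton (α : ℝ) (xs : List 𝒳) (x : 𝒳) :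
    readAll α (xs ++ [x]) = readStep α (readAll α xs) x := by
  simp [readAll, List.foldl_append]

theorem readAll_n (α : ℝ) (xs : List 𝒳) : (readAll α xs).n = xs.length := by
  induction xs using List.reverseRecOn with
  | nil => rfl
  | append_singleton xs x ih => simp [readAll_append_singleton, readStep, ih]

theorem readAll_sketch_append_singleton (α : ℝ) (xs : List 𝒳) (x : 𝒳) :
    (readAll α (xs ++ [x])).sketch = update α xs.length x (readAll α xs).sketch := by
  simp [readAll_append_singleton, readStep, readAll_n]

theorem sketch_induction {α : ℝ} {P : List 𝒳 → List (GKTuple 𝒳) → Prop} (hnil : P [] [])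
    (hdel : ∀ xs L D t cur R, Deletion α xs.length L D t cur → P xs (L ++ (D ++ t :: cur :: R)) →
      P xs (L ++ { cur with g := t.g + gSum D + cur.g } :: R))
    (hins : ∀ xs x S, P xs S → P (xs ++ [x]) (insert α xs.length x S)) (xs : List 𝒳) :
    P xs (readAll α xs).sketch := by
  induction xs using List.reverseRecOn with
  | nil => exact hnil
  | append_singleton xs x ih =>
    rw [readAll_sketch_append_singleton]
    unfold update
    refine hins _ _ _ ?_
    split_ifs
    · exact compress_induction (hdel xs) _ ih
    · exact ih

/-- The rank interval of every tuple of a sketch, preceded by tuples of total weight `acc`,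
contains a rank of its value in `xs`. -/
def RanksCorrect (xs : List 𝒳) : ℕ → List (GKTuple 𝒳) → Prop
  | _, [] => True
  | acc, t :: R =>
    acc + t.g ≤ xs.countP (fun y => decide (y ≤ t.val)) ∧
    xs.countP (fun y => decide (y < t.val)) + 1 ≤ acc + t.g + t.Δ ∧
    RanksCorrect xs (acc + t.g) R

theorem ranksCorrect_append {xs : List 𝒳} {acc : ℕ} {L R : List (GKTuple 𝒳)} :
    RanksCorrect xs acc (L ++ R) ↔
      RanksCorrect xs acc L ∧ RanksCorrect xs (acc + gSum L) R := by
  induction L generalizing acc with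
  | nil => simp [RanksCorrect]
  | cons t L ih => simp [RanksCorrect, ih, add_assoc, and_assoc]

theorem RanksCorrect.of_val_le {xs : List 𝒳} {x : 𝒳} {acc : ℕ} {L : List (GKTuple 𝒳)}
    (h : RanksCorrect xs acc L) (hL : ∀ t ∈ L, t.val ≤ x) :
    RanksCorrect (xs ++ [x]) acc L := by
  induction L generalizing acc with
  | nil => trivial
  | cons t L ih =>
    obtain ⟨h1, h2, h3⟩ := h
    refine ⟨?_, ?_, ih h3 fun s hs => hL s (by simp [hs])⟩
    · rw [List.countP_append]; omega
    · rw [List.countP_append]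
      have : ¬ x < t.val := not_lt.2 (hL t (by simp))
      simpa [this] using h2

theorem RanksCorrect.of_lt_val {xs : List 𝒳} {x : 𝒳} {acc : ℕ} {L : List (GKTuple 𝒳)}
    (h : RanksCorrect xs acc L) (hL : ∀ t ∈ L, x < t.val) :
    RanksCorrect (xs ++ [x]) (acc + 1) L := by
  induction L generalizing acc with
  | nil => trivial
  | cons t L ih =>
    obtain ⟨h1, h2, h3⟩ := h
    have hx : x < t.val := hL t (by simp)
    refine ⟨?_, ?_, ?_⟩
    · rw [List.countP_append]
      simp [hx.le]; omega
    · rw [List.countP_append]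
      simp [hx]; omega
    · have := ih h3 fun s hs => hL s (by simp [hs])
      rwa [show acc + 1 + t.g = acc + t.g + 1 by ring]

theorem countP_le_countP {ι : Type*} {xs : List ι} {p q : ι → Prop} [DecidablePred p] [DecidablePred q]
    (h : ∀ y, p y → q y) :
    xs.countP (fun y => decide (p y)) ≤ xs.countP (fun y => decide (q y)) :=
  List.countP_mono_left fun y _ => by simpa using h y

/-- If all values in an initial segment of the sketch are at most `x`, its weight is at most
the number of elements that are at most `x`. -/
theorem RanksCorrect.gSum_le {xs : List 𝒳} {L : List (GKTuple 𝒳)}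
    (h : RanksCorrect xs 0 L) {P : 𝒳 → Prop} [DecidablePred P]
    (hL : ∀ t ∈ L, ∀ y ≤ t.val, P y) :
    gSum L ≤ xs.countP (fun y => decide (P y)) := by
  rcases List.eq_nil_or_concat L with rfl | ⟨L', t, rfl⟩
  · simp
  · rw [List.concat_eq_append] at *
    rw [ranksCorrect_append] at h
    have := h.2.1
    simp only [gSum_append, gSum_cons, gSum_nil]
    have h2 : xs.countP (fun y => decide (y ≤ t.val)) ≤ xs.countP (fun y => decide (P y)) :=
      countP_le_countP (hL t (by simp))
    omega

/-- The invariants of the sketch that concern ranks. -/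
structure RankInv (α : ℝ) (xs : List 𝒳) (S : List (GKTuple 𝒳)) : Prop where
  sorted : S.Pairwise fun s t => s.val ≤ t.val
  total : gSum S = xs.length
  pos : ∀ t ∈ S, 0 < t.g
  bound : ∀ t ∈ S, t.g + t.Δ ≤ ⌊2 * α * (xs.length : ℝ)⌋₊ + 1
  head : ∀ t R, S = t :: R → t.g = 1 ∧ t.Δ = 0
  ranks : RanksCorrect xs 0 S

/-- The prefix sums up to `cur` and beyond are unchanged, so the remaining rank intervals stay
correct. The bound on `g + Δ` is the test made by compress. -/
theorem RankInv.deletion {α : ℝ} {xs : List 𝒳} {L D R : List (GKTuple 𝒳)} {t cur : GKTuple 𝒳}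
    (hd : Deletion α xs.length L D t cur) (h : RankInv α xs (L ++ (D ++ t :: cur :: R))) :
    L ≠ [] ∧ RankInv α xs (L ++ { cur with g := t.g + gSum D + cur.g } :: R) := by
  -- The algorithm protects the first tuple only from being `t`. It is not a descendant either,
  -- because its `Δ` is 0.
  have hL : L ≠ [] := by
    rintro rfl
    cases D with
    | nil => exact hd.not_first rfl
    | cons r D =>
      have h1 := hd.desc r (by simp)
      rw [(h.head r _ rfl).2] at h1
      exact band_zero_le_imp h1
  refine ⟨hL, ?_, ?_, ?_, ?_, ?_, ?_⟩
  · have h1 : (L ++ cur :: R).Pairwise fun s t => s.val ≤ t.val :=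
      h.sorted.sublist (List.Sublist.append_left
        ((List.sublist_cons_self t (cur :: R)).trans (List.sublist_append_right D _)) L)
    have h2 : ((L ++ cur :: R).map GKTuple.val).Pairwise (· ≤ ·) := List.pairwise_map.2 h1
    have h3 : ((L ++ { cur with g := t.g + gSum D + cur.g } :: R).map GKTuple.val).Pairwise
        (· ≤ ·) := by simpa using h2
    exact List.pairwise_map.1 h3
  · rw [← h.total]; simp; ring
  · intro s hs
    rcases List.mem_append.1 hs with hs | hs
    · exact h.pos s (by simp [hs])
    · rcases List.mem_cons.1 hs with rfl | hs
      · have := h.pos t (by simp)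
        simp only; omega
      · exact h.pos s (by simp [hs])
  · intro s hs
    rcases List.mem_append.1 hs with hs | hs
    · exact h.bound s (by simp [hs])
    · rcases List.mem_cons.1 hs with rfl | hs
      · have := hd.small
        simp only; omega
      · exact h.bound s (by simp [hs])
  · intro s R' hs
    cases L with
    | nil => exact absurd rfl hL
    | cons s' L =>
      simp only [List.cons_append, List.cons.injEq] at hs
      exact hs.1 ▸ h.head s' _ rfl
  · have h1 := h.ranks
    simp only [ranksCorrect_append, RanksCorrect] at h1 ⊢
    obtain ⟨h1, h2, h3, h4, h5, h6, h7⟩ := h1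
    have he : 0 + gSum L + (t.g + gSum D + cur.g) = 0 + gSum L + gSum D + t.g + cur.g := by ring
    rw [he]
    exact ⟨h1, h5, h6, h7⟩

/-- The parts of a sketch to the left and to the right of a new element. -/
theorem exists_insert_eq {S : List (GKTuple 𝒳)} (hS : S.Pairwise fun s t => s.val ≤ t.val)
    (α : ℝ) (m : ℕ) (x : 𝒳) :
    ∃ l r, S = l ++ r ∧ (∀ t ∈ l, t.val ≤ x) ∧ (∀ t ∈ r, x < t.val) ∧
      insert α m x S =
        l ++ ⟨x, 1, if l = [] ∨ r = [] then 0 else ⌊2 * α * (m : ℝ)⌋₊⟩ :: r := by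
  refine ⟨S.takeWhile fun t => decide (t.val ≤ x), S.dropWhile fun t => decide (t.val ≤ x),
    (List.takeWhile_append_dropWhile).symm, fun t ht => by
      simpa using List.mem_takeWhile_imp ht, ?_, ?_⟩
  · intro t ht
    cases hr : S.dropWhile fun t => decide (t.val ≤ x) with
    | nil => rw [hr] at ht; simp at ht
    | cons s r =>
      have hne : (S.dropWhile fun t => decide (t.val ≤ x)) ≠ [] := by simp [hr]
      have h1 := List.head_dropWhile_not (fun t : GKTuple 𝒳 => decide (t.val ≤ x)) hne
      have hh : (S.dropWhile fun t => decide (t.val ≤ x)).head hne = s := by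
        simp only [hr, List.head_cons]
      rw [hh] at h1
      have h2 : x < s.val := by simpa using h1
      have h3 := hS.sublist (List.dropWhile_sublist (fun t : GKTuple 𝒳 => decide (t.val ≤ x)))
      rw [hr] at h3 ht
      rcases List.mem_cons.1 ht with rfl | ht
      · exact h2
      · exact h2.trans_le (List.rel_of_pairwise_cons h3 ht)
  · simp [insert]

theorem floor_mono {α : ℝ} (hα : 0 < α) {m m' : ℕ} (h : m ≤ m') :
    ⌊2 * α * (m : ℝ)⌋₊ ≤ ⌊2 * α * (m' : ℝ)⌋₊ :=
  Nat.floor_le_floor (by gcongr)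

/-- The upper rank bound of an interior new tuple comes from its right neighbour `s`: fewer than
`gSum l + s.g + s.Δ` elements lie below `s.val`, and `s.g + s.Δ ≤ ⌊2αn⌋ + 1`. -/
theorem RankInv.insert {α : ℝ} (hα : 0 < α) {xs : List 𝒳} {x : 𝒳} {S : List (GKTuple 𝒳)}
    (h : RankInv α xs S) : RankInv α (xs ++ [x]) (insert α xs.length x S) := by
  obtain ⟨l, r, rfl, hl, hr, heq⟩ := exists_insert_eq h.sorted α xs.length x
  rw [heq]
  have hfl := floor_mono hα (Nat.le_succ xs.length)
  have hlen : (xs ++ [x]).length = xs.length.succ := by simp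
  set Δ := if l = [] ∨ r = [] then 0 else ⌊2 * α * (xs.length : ℝ)⌋₊ with hΔ
  have hΔle : Δ ≤ ⌊2 * α * (xs.length : ℝ)⌋₊ := by rw [hΔ]; split_ifs <;> simp
  have hs := List.pairwise_append.1 h.sorted
  have hrk := ranksCorrect_append.1 h.ranks
  rw [zero_add] at hrk
  refine ⟨?_, ?_, ?_, ?_, ?_, ?_⟩
  · refine List.pairwise_append.2 ⟨hs.1, List.pairwise_cons.2 ⟨fun t ht => (hr t ht).le, hs.2.1⟩, ?_⟩
    intro s hsl t ht
    rcases List.mem_cons.1 ht with rfl | ht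
    · exact hl s hsl
    · exact hs.2.2 s hsl t ht
  · have := h.total
    simp at this ⊢; omega
  · intro s hs
    rcases List.mem_append.1 hs with hs | hs
    · exact h.pos s (by simp [hs])
    · rcases List.mem_cons.1 hs with rfl | hs
      · simp
      · exact h.pos s (by simp [hs])
  · intro s hs
    rw [hlen]
    rcases List.mem_append.1 hs with hs | hs
    · exact (h.bound s (by simp [hs])).trans (by omega)
    · rcases List.mem_cons.1 hs with rfl | hs
      · simp only; omega
      · exact (h.bound s (by simp [hs])).trans (by omega)
  · intro s R' hs
    cases l with
    | nil =>
      simp only [List.nil_append, List.cons.injEq] at hs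
      rw [← hs.1]
      simp [hΔ]
    | cons s' l =>
      simp only [List.cons_append, List.cons.injEq] at hs
      exact hs.1 ▸ h.head s' _ rfl
  · rw [ranksCorrect_append, zero_add]
    refine ⟨hrk.1.of_val_le hl, ?_, ?_, hrk.2.of_lt_val hr⟩
    · rw [List.countP_append]
      have := hrk.1.gSum_le (P := fun y => y ≤ x) fun t ht y hy => hy.trans (hl t ht)
      simp; omega
    · rw [List.countP_append]
      simp only [lt_self_iff_false, decide_false, List.countP_singleton, Bool.false_eq_true,
        if_false, add_zero]
      cases r with
      | nil =>
        have h1 := h.total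
        have h2 : xs.countP (fun y => decide (y < x)) ≤ xs.length := List.countP_le_length
        simp at h1
        omega
      | cons s r =>
        have h2 := hrk.2.2.1
        have h3 : xs.countP (fun y => decide (y < x)) ≤ xs.countP (fun y => decide (y < s.val)) :=
          countP_le_countP fun y hy => hy.trans (hr s (by simp))
        -- A new minimum receives `Δ = 0`. This is sound because the old first tuple has `g = 1` and
        -- `Δ = 0`, so no earlier element is below it.
        cases l with
        | nil =>
          have h4 := h.head s r rfl
          simp at h2 ⊢; omega
        | cons t l =>
          have h4 := h.bound s (by simp)
          have h5 : Δ = ⌊2 * α * (xs.length : ℝ)⌋₊ := by simp [hΔ]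
          omega

theorem rankInv_nil (α : ℝ) : RankInv α ([] : List 𝒳) [] :=
  ⟨List.Pairwise.nil, rfl, by simp, by simp, by simp, trivial⟩

theorem rankInv_readAll {α : ℝ} (hα : 0 < α) (xs : List 𝒳) :
    RankInv α xs (readAll α xs).sketch :=
  sketch_induction (rankInv_nil α) (fun _ _ _ _ _ _ hd h => (h.deletion hd).2)
    (fun _ _ _ h => h.insert hα) xs

end Ranks

/-! ## Band invariants of the sketch -/

section BandInvariants

variable {𝒳 : Type u}

/-- A sketch in which every tuple is annotated with the initial `Δ`-values of all elements that
were merged into it. -/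
abbrev AnnSketch (𝒳 : Type u) := List (GKTuple 𝒳 × Multiset ℕ)

/-- For the first tuple with `Δ ≤ T`, the sum of `Δ` and the number of the elements merged into it
whose initial `Δ` was at most `T`. -/
def firstLow (T : ℕ) : AnnSketch 𝒳 → ℕ
  | [] => 0
  | a :: R => if T < a.1.Δ then firstLow T R else a.2.countP (· ≤ T) + a.1.Δ

/-- When a tuple with `Δ > T` was inserted, the next tuple to the right with `Δ ≤ T` satisfied
`g + Δ ≤ Δ' + 1` for the `Δ'` of the new tuple. As long as the new tuple is not deleted, only
elements of initial `Δ`-value more than `T` are merged into the other one. -/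
def LowBounded (T : ℕ) : AnnSketch 𝒳 → Prop
  | [] => True
  | a :: R => (T < a.1.Δ → firstLow T R ≤ a.1.Δ + 1) ∧ LowBounded T R

theorem LowBounded.of_append {T : ℕ} {L R : AnnSketch 𝒳} (h : LowBounded T (L ++ R)) :
    LowBounded T R := by
  induction L with
  | nil => exact h
  | cons a L ih => exact ih h.2

/-- The slack `T + 2` is free: `firstLow T` is only ever compared with `Δ + 1` for some `Δ > T`. -/
theorem firstLow_append_le {T : ℕ} {L X X' : AnnSketch 𝒳}
    (h : firstLow T X' ≤ max (firstLow T X) (T + 2)) :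
    firstLow T (L ++ X') ≤ max (firstLow T (L ++ X)) (T + 2) := by
  induction L with
  | nil => exact h
  | cons a L ih =>
    simp only [List.cons_append, firstLow]
    split_ifs
    · exact ih
    · exact le_max_left _ _

theorem LowBounded.append_of_firstLow_le {T : ℕ} {L X X' : AnnSketch 𝒳}
    (h : LowBounded T (L ++ X)) (hX' : LowBounded T X')
    (hle : firstLow T X' ≤ max (firstLow T X) (T + 2)) : LowBounded T (L ++ X') := by
  induction L with
  | nil => exact hX'
  | cons a L ih =>
    refine ⟨fun ha => ?_, ih h.2⟩
    have h1 : firstLow T (L ++ X) ≤ a.1.Δ + 1 := h.1 ha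
    change firstLow T (L ++ X') ≤ a.1.Δ + 1
    have h2 := firstLow_append_le (L := L) hle
    rcases le_max_iff.1 h2 with h3 | h3
    · exact h3.trans h1
    · omega

theorem firstLow_append_of_le {T : ℕ} {L X X' : AnnSketch 𝒳} {w : GKTuple 𝒳 × Multiset ℕ}
    (hw : w.1.Δ ≤ T) : firstLow T (L ++ w :: X') = firstLow T (L ++ w :: X) := by
  induction L with
  | nil => simp [firstLow, not_lt.2 hw]
  | cons a L ih => simp only [List.cons_append, firstLow, ih]

/-- A tuple with `Δ ≤ T` is a shield: the search performed by `firstLow` from its left never looks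
past it. -/
theorem LowBounded.append_of_le {T : ℕ} {L X X' : AnnSketch 𝒳} {w : GKTuple 𝒳 × Multiset ℕ}
    (hw : w.1.Δ ≤ T) (h : LowBounded T (L ++ w :: X)) (hX' : LowBounded T X') :
    LowBounded T (L ++ w :: X') := by
  induction L with
  | nil => exact ⟨fun h' => absurd h' (not_lt.2 hw), hX'⟩
  | cons a L ih =>
    refine ⟨fun ha => ?_, ih h.2⟩
    change firstLow T (L ++ w :: X') ≤ a.1.Δ + 1
    rw [firstLow_append_of_le (X := X) hw]
    exact h.1 ha

theorem firstLow_append_of_lt {T : ℕ} {D X : AnnSketch 𝒳} (hD : ∀ a ∈ D, T < a.1.Δ) :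
    firstLow T (D ++ X) = firstLow T X := by
  induction D with
  | nil => rfl
  | cons a D ih =>
    rw [List.cons_append, firstLow, if_pos (hD a (by simp))]
    exact ih fun b hb => hD b (by simp [hb])

theorem firstLow_le {T B : ℕ} {L : AnnSketch 𝒳}
    (h : ∀ a ∈ L, Multiset.card a.2 + a.1.Δ ≤ B) : firstLow T L ≤ B := by
  induction L with
  | nil => simp [firstLow]
  | cons a L ih =>
    rw [firstLow]
    split_ifs
    · exact ih fun b hb => h b (by simp [hb])
    · have h1 := h a (by simp)
      have h2 := Multiset.countP_le_card (· ≤ T) a.2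
      omega

/-- The elements merged into the tuples of an annotated sketch. -/
def merged (A : AnnSketch 𝒳) : Multiset ℕ := (A.map Prod.snd).sum

@[simp] theorem merged_nil : merged ([] : AnnSketch 𝒳) = 0 := rfl

@[simp] theorem merged_cons (a : GKTuple 𝒳 × Multiset ℕ) (A : AnnSketch 𝒳) :
    merged (a :: A) = a.2 + merged A := by simp [merged]

@[simp] theorem merged_append (A B : AnnSketch 𝒳) : merged (A ++ B) = merged A + merged B := by
  simp [merged]

theorem mem_merged {A : AnnSketch 𝒳} {d : ℕ} : d ∈ merged A ↔ ∃ a ∈ A, d ∈ a.2 := by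
  induction A with
  | nil => simp
  | cons a A ih => simp [ih]

theorem card_merged {A : AnnSketch 𝒳} (h : ∀ a ∈ A, Multiset.card a.2 = a.1.g) :
    Multiset.card (merged A) = gSum (A.map Prod.fst) := by
  induction A with
  | nil => simp
  | cons a A ih =>
    simp [h a (by simp), ih fun b hb => h b (by simp [hb])]

/-- The invariants of the sketch that concern bands. -/
structure BandInv (α : ℝ) (m : ℕ) (A : AnnSketch 𝒳) : Prop where
  card : ∀ a ∈ A, Multiset.card a.2 = a.1.g
  own : ∀ a ∈ A, a.1.Δ ∈ a.2
  le : ∀ a ∈ A, ∀ d ∈ a.2, BandLE ⌊2 * α * (m : ℝ)⌋₊ d a.1.Δ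
  low : ∀ T, IsThreshold ⌊2 * α * (m : ℝ)⌋₊ T → LowBounded T A
  count : ∀ T, (merged A).countP (T < ·) ≤
    ((Finset.range m).filter fun j : ℕ => T < ⌊2 * α * (j : ℝ)⌋₊).card

theorem BandInv.deletion {α : ℝ} {m : ℕ} {L D R : AnnSketch 𝒳}
    {t cur : GKTuple 𝒳 × Multiset ℕ} (hL : L ≠ [])
    (hΔ : ∀ a ∈ L ++ (D ++ t :: cur :: R), a.1.Δ ≤ ⌊2 * α * (m : ℝ)⌋₊)
    (hd : Deletion α m (L.map Prod.fst) (D.map Prod.fst) t.1 cur.1)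
    (h : BandInv α m (L ++ (D ++ t :: cur :: R))) :
    BandInv α m (L ++ ({ cur.1 with g := t.1.g + gSum (D.map Prod.fst) + cur.1.g },
      t.2 + merged D + cur.2) :: R) := by
  have htc : BandLE ⌊2 * α * (m : ℝ)⌋₊ t.1.Δ cur.1.Δ :=
    bandLE_of_band_le (hΔ cur (by simp)) hd.band_le
  have hDt : ∀ r ∈ D, BandLE ⌊2 * α * (m : ℝ)⌋₊ r.1.Δ t.1.Δ := fun r hr =>
    bandLE_of_band_le (hΔ t (by simp)) (hd.desc r.1 (List.mem_map_of_mem hr)).le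
  refine ⟨?_, ?_, ?_, ?_, ?_⟩
  · intro a ha
    rcases List.mem_append.1 ha with ha | ha
    · exact h.card a (by simp [ha])
    · rcases List.mem_cons.1 ha with rfl | ha
      · simp only [Multiset.card_add]
        rw [h.card t (by simp), h.card cur (by simp),
          card_merged fun a ha => h.card a (by simp [ha])]
      · exact h.card a (by simp [ha])
  · intro a ha
    rcases List.mem_append.1 ha with ha | ha
    · exact h.own a (by simp [ha])
    · rcases List.mem_cons.1 ha with rfl | ha
      · simp [h.own cur (by simp)]
      · exact h.own a (by simp [ha])
  · intro a ha d hda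
    rcases List.mem_append.1 ha with ha | ha
    · exact h.le a (by simp [ha]) d hda
    · rcases List.mem_cons.1 ha with rfl | ha
      · simp only [Multiset.mem_add, mem_merged] at hda ⊢
        rcases hda with (hda | ⟨r, hr, hdr⟩) | hda
        · exact (h.le t (by simp) d hda).trans htc
        · exact ((h.le r (by simp [hr]) d hdr).trans (hDt r hr)).trans htc
        · exact h.le cur (by simp) d hda
      · exact h.le a (by simp [ha]) d hda
  · intro T hT
    have h0 := h.low T hT
    have hR : LowBounded T (cur :: R) := by
      have h1 := h0.of_append.of_append
      exact h1.2
    have hR' : LowBounded T (({ cur.1 with g := t.1.g + gSum (D.map Prod.fst) + cur.1.g },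
        t.2 + merged D + cur.2) :: R) := ⟨hR.1, hR.2⟩
    -- If `t` is above the threshold, so are its descendants and everything ever merged into them.
    -- The merge then adds no element with initial `Δ ≤ T` to `cur`, and `firstLow` does not change.
    by_cases ht : T < t.1.Δ
    · refine h0.append_of_firstLow_le hR' (le_max_of_le_left (le_of_eq ?_))
      rw [firstLow_append_of_lt fun r hr => hDt r hr T hT ht, firstLow, firstLow, firstLow,
        if_pos ht]
      simp only
      split_ifs
      · rfl
      · have h1 : t.2.countP (· ≤ T) = 0 :=
          Multiset.countP_eq_zero.2 fun d hd' => not_le.2 (h.le t (by simp) d hd' T hT ht)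
        have h2 : (merged D).countP (· ≤ T) = 0 := by
          refine Multiset.countP_eq_zero.2 fun d hd' => not_le.2 ?_
          obtain ⟨r, hr, hdr⟩ := mem_merged.1 hd'
          exact h.le r (by simp [hr]) d hdr T hT (hDt r hr T hT ht)
        simp [Multiset.countP_add, h1, h2]
    -- If `t` is below the threshold, maximality of the descendant run gives a left neighbour `w` of
    -- no smaller band. So `w` is also below the threshold and shields the tuples on its left.
    · rcases List.eq_nil_or_concat L with rfl | ⟨L', w, rfl⟩
      · exact absurd rfl hL
      · rw [List.concat_eq_append] at *
        rw [List.append_assoc, List.singleton_append] at h0 ⊢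
        have hw := hd.maximal (L'.map Prod.fst) w.1 (by simp)
        have hw' := bandLE_of_band_le (hΔ w (by simp)) hw T hT
        exact h0.append_of_le (not_lt.1 fun hlt => ht (hw' hlt)) hR'
  · intro T
    refine le_trans (le_of_eq ?_) (h.count T)
    simp only [merged_append, merged_cons]
    congr 1
    abel

theorem BandInv.insert {α : ℝ} (hα : 0 < α) {m : ℕ} {l r : AnnSketch 𝒳} {x : 𝒳} {Δ : ℕ}
    (hΔ : Δ = 0 ∨ Δ = ⌊2 * α * (m : ℝ)⌋₊)
    (hb : ∀ a ∈ l ++ r, a.1.g + a.1.Δ ≤ ⌊2 * α * (m : ℝ)⌋₊ + 1)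
    (h : BandInv α m (l ++ r)) : BandInv α (m + 1) (l ++ (⟨x, 1, Δ⟩, {Δ}) :: r) := by
  have hfl := floor_mono hα (Nat.le_succ m)
  refine ⟨?_, ?_, ?_, ?_, ?_⟩
  · intro a ha
    rcases List.mem_append.1 ha with ha | ha
    · exact h.card a (by simp [ha])
    · rcases List.mem_cons.1 ha with rfl | ha
      · simp
      · exact h.card a (by simp [ha])
  · intro a ha
    rcases List.mem_append.1 ha with ha | ha
    · exact h.own a (by simp [ha])
    · rcases List.mem_cons.1 ha with rfl | ha
      · simp
      · exact h.own a (by simp [ha])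
  · intro a ha d hda
    rcases List.mem_append.1 ha with ha | ha
    · exact (h.le a (by simp [ha]) d hda).mono hfl
    · rcases List.mem_cons.1 ha with rfl | ha
      · simp only [Multiset.mem_singleton] at hda
        exact hda ▸ BandLE.refl _ _
      · exact (h.le a (by simp [ha]) d hda).mono hfl
  · intro T hT
    have h0 := h.low T (hT.anti hfl)
    have hr := h0.of_append
    -- A new tuple above `T` has `Δ = ⌊2αm⌋`, and every old tuple satisfies `g + Δ' ≤ ⌊2αm⌋ + 1`. A
    -- new tuple below `T` has one merged element, so its `firstLow` is at most `T + 1`.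
    refine h0.append_of_firstLow_le ⟨fun hlt => ?_, hr⟩ ?_
    · simp only at hlt ⊢
      rcases hΔ with rfl | rfl
      · omega
      · refine firstLow_le fun a ha => ?_
        rw [h.card a (by simp [ha])]
        exact hb a (by simp [ha])
    · rw [firstLow]
      split_ifs with hlt
      · exact le_max_left _ _
      · simp only at hlt
        have h2 := Multiset.countP_le_card (· ≤ T) ({Δ} : Multiset ℕ)
        rw [Multiset.card_singleton] at h2
        refine le_max_of_le_right ?_
        simp only
        omega
  · intro T
    have h1 := h.count T
    rw [Finset.range_add_one, Finset.filter_insert]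
    simp only [merged_append, merged_cons, Multiset.countP_add] at h1 ⊢
    have h2 := Multiset.countP_le_card (T < ·) ({Δ} : Multiset ℕ)
    rw [Multiset.card_singleton] at h2
    split_ifs with hlt
    · rw [Finset.card_insert_of_notMem (by simp)]
      omega
    · have h3 : ({Δ} : Multiset ℕ).countP (T < ·) = 0 := by
        rw [Multiset.countP_eq_zero]
        intro d hd
        rw [Multiset.mem_singleton] at hd
        omega
      omega

/-- A sketch has an annotation with the band invariants. -/
def HasBandInv (α : ℝ) (m : ℕ) (S : List (GKTuple 𝒳)) : Prop :=
  ∃ A : AnnSketch 𝒳, A.map Prod.fst = S ∧ BandInv α m A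

theorem hasBandInv_deletion [LinearOrder 𝒳] {α : ℝ} {xs : List 𝒳} {L D R : List (GKTuple 𝒳)}
    {t cur : GKTuple 𝒳} (hd : Deletion α xs.length L D t cur)
    (h : RankInv α xs (L ++ (D ++ t :: cur :: R)))
    (hA : HasBandInv α xs.length (L ++ (D ++ t :: cur :: R))) :
    HasBandInv α xs.length (L ++ { cur with g := t.g + gSum D + cur.g } :: R) := by
  obtain ⟨A, hA, hinv⟩ := hA
  obtain ⟨L', A₁, rfl, rfl, hA₁⟩ := List.map_eq_append_iff.1 hA
  obtain ⟨D', A₂, rfl, rfl, hA₂⟩ := List.map_eq_append_iff.1 hA₁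
  obtain ⟨t', A₃, rfl, rfl, hA₃⟩ := List.map_eq_cons_iff.1 hA₂
  obtain ⟨cur', R', rfl, rfl, rfl⟩ := List.map_eq_cons_iff.1 hA₃
  refine ⟨_, ?_, hinv.deletion ?_ ?_ hd⟩
  · simp
  · have := (h.deletion hd).1
    simpa using this
  · intro a ha
    have h1 : a.1 ∈ (L' ++ (D' ++ t' :: cur' :: R')).map Prod.fst := List.mem_map_of_mem ha
    have h2 := h.bound a.1 (by simpa using h1)
    have h3 := h.pos a.1 (by simpa using h1)
    omega

theorem hasBandInv_insert [LinearOrder 𝒳] {α : ℝ} (hα : 0 < α) {xs : List 𝒳} (x : 𝒳)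
    {S : List (GKTuple 𝒳)} (h : RankInv α xs S) (hA : HasBandInv α xs.length S) :
    HasBandInv α (xs ++ [x]).length (insert α xs.length x S) := by
  obtain ⟨l, r, rfl, -, -, heq⟩ := exists_insert_eq h.sorted α xs.length x
  rw [heq]
  obtain ⟨A, hA, hinv⟩ := hA
  obtain ⟨l', r', rfl, rfl, rfl⟩ := List.map_eq_append_iff.1 hA
  rw [List.length_append, List.length_singleton]
  refine ⟨_, ?_, hinv.insert hα (x := x) (Δ := if l'.map Prod.fst = [] ∨ r'.map Prod.fst = []
    then 0 else ⌊2 * α * (xs.length : ℝ)⌋₊) ?_ ?_⟩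
  · simp
  · split_ifs <;> simp
  · intro a ha
    have h1 : a.1 ∈ (l' ++ r').map Prod.fst := List.mem_map_of_mem ha
    exact h.bound a.1 (by simpa using h1)

theorem hasBandInv_readAll [LinearOrder 𝒳] {α : ℝ} (hα : 0 < α) (xs : List 𝒳) :
    HasBandInv α xs.length (readAll α xs).sketch := by
  have : RankInv α xs (readAll α xs).sketch ∧ HasBandInv α xs.length (readAll α xs).sketch := by
    refine sketch_induction (P := fun xs S => RankInv α xs S ∧ HasBandInv α xs.length S)
      ⟨rankInv_nil α, [], rfl, by simp, by simp, by simp, fun _ _ => trivial, by simp⟩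
      (fun _ _ _ _ _ _ hd h => ⟨(h.1.deletion hd).2, hasBandInv_deletion hd h.1 h.2⟩)
      (fun _ x _ h => ⟨h.1.insert hα, hasBandInv_insert hα x h.1 h.2⟩) xs
  exact this.2

end BandInvariants

/-! ## The size of the sketch -/

section Space

variable {𝒳 : Type u}

theorem exists_first_or_forall {ι : Type*} (P : ι → Prop) (L : List ι) :
    (∀ a ∈ L, ¬ P a) ∨ ∃ run e R, L = run ++ e :: R ∧ (∀ a ∈ run, ¬ P a) ∧ P e := by
  induction L with
  | nil => exact Or.inl (by simp)
  | cons a L ih =>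
    by_cases ha : P a
    · exact Or.inr ⟨[], a, L, rfl, by simp, ha⟩
    · rcases ih with h | ⟨run, e, R, rfl, h1, h2⟩
      · exact Or.inl (by simpa [ha] using h)
      · exact Or.inr ⟨a :: run, e, R, rfl, by simpa [ha] using h1, h2⟩

theorem length_eq_sum_countP {ι : Type*} (f : ι → ℕ) (K : ℕ) (L : List ι)
    (h : ∀ x ∈ L, f x < K) :
    L.length = ∑ a ∈ Finset.range K, L.countP fun x => decide (f x = a) := by
  induction L with
  | nil => simp
  | cons x L ih =>
    simp only [List.countP_cons, Finset.sum_add_distrib, List.length_cons]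
    rw [ih fun y hy => h y (by simp [hy])]
    congr 1
    simp [Finset.sum_ite_eq, h x (by simp)]

theorem IsCompressed.of_append {p m : ℕ} {L R : List (GKTuple 𝒳)}
    (h : IsCompressed p m (L ++ R)) : IsCompressed p m R := by
  induction L with
  | nil => exact h
  | cons t L ih =>
    refine ih ?_
    match hLR : L ++ R, h with
    | [], _ => simp [IsCompressed]
    | [_], _ => simp [IsCompressed]
    | _ :: _ :: _, h => rw [List.cons_append, hLR] at h; exact h.2

/-- The number of elements of band at most `a` among those merged into the tuples of a list. -/
def bandMass (p a : ℕ) (h : Multiset ℕ) : ℕ := h.countP fun d => band p d ≤ a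

@[simp] theorem bandMass_add (p a : ℕ) (h h' : Multiset ℕ) :
    bandMass p a (h + h') = bandMass p a h + bandMass p a h' := Multiset.countP_add _ _ _

/-- The annotation of single tuples in an annotated sketch. -/
structure AnnCorrect (p : ℕ) (A : AnnSketch 𝒳) : Prop where
  card : ∀ a ∈ A, Multiset.card a.2 = a.1.g
  own : ∀ a ∈ A, a.1.Δ ∈ a.2
  le : ∀ a ∈ A, ∀ d ∈ a.2, BandLE p d a.1.Δ

theorem AnnCorrect.of_subset {p : ℕ} {A B : AnnSketch 𝒳} (h : AnnCorrect p A) (hB : B ⊆ A) :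
    AnnCorrect p B :=
  ⟨fun a ha => h.card a (hB ha), fun a ha => h.own a (hB ha), fun a ha => h.le a (hB ha)⟩

theorem AnnCorrect.bandMass_eq {p b : ℕ} {A : AnnSketch 𝒳} (h : AnnCorrect p A)
    {a : GKTuple 𝒳 × Multiset ℕ} (ha : a ∈ A) (hb : band p a.1.Δ ≤ b) :
    bandMass p b a.2 = a.1.g := by
  rw [← h.card a ha, bandMass, Multiset.countP_eq_card]
  exact fun d hd => (h.le a ha d hd).band_le hb

theorem AnnCorrect.bandMass_merged {p b : ℕ} {A : AnnSketch 𝒳} (h : AnnCorrect p A)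
    (hb : ∀ a ∈ A, band p a.1.Δ ≤ b) : bandMass p b (merged A) = gSum (A.map Prod.fst) := by
  induction A with
  | nil => rfl
  | cons a A ih =>
    rw [merged_cons, bandMass_add, h.bandMass_eq (by simp) (hb a (by simp)),
      ih (h.of_subset (by simp)) fun c hc => hb c (by simp [hc])]
    simp

theorem runSum_le_bandMass {p b : ℕ} {A : AnnSketch 𝒳} (h : AnnCorrect p A) :
    runSum p b (A.map Prod.fst) ≤ bandMass p b (merged A) := by
  induction A with
  | nil => simp
  | cons a A ih =>
    rw [merged_cons, bandMass_add, List.map_cons, runSum_cons]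
    split_ifs with hb
    · rw [h.bandMass_eq (by simp) hb.le]
      have := ih (h.of_subset (by simp))
      omega
    · exact Nat.zero_le _

theorem runSum_append_of_lt {p b : ℕ} {L R : List (GKTuple 𝒳)} (h : ∀ t ∈ L, band p t.Δ < b) :
    runSum p b (L ++ R) = gSum L + runSum p b R := by
  induction L with
  | nil => simp
  | cons t L ih =>
    rw [List.cons_append, runSum_cons, if_pos (h t (by simp)), ih fun s hs => h s (by simp [hs]),
      gSum_cons, add_assoc]

/-- Consecutive tuples of band at least `a` in a compressed sketch, the left one in band `a` and
not the first of the sketch. -/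
theorem le_of_isCompressed {p m a : ℕ} (hpm : p ≤ m) {e e' : GKTuple 𝒳 × Multiset ℕ}
    {run L R : AnnSketch 𝒳} (hA : AnnCorrect p (e :: run ++ e' :: L))
    (hc : IsCompressed p m ((e :: run ++ e' :: L).map Prod.fst))
    (hlow : ∀ T, IsThreshold p T → LowBounded T ((e :: run ++ e' :: L).reverse ++ R))
    (he : a ≤ band p e.1.Δ) (hrun : ∀ r ∈ run, band p r.1.Δ < a) (he' : band p e'.1.Δ = a)
    (hL : L ≠ []) :
    max 1 (2 ^ (a - 1) - 1) ≤ bandMass p a e.2 + gSum (run.map Prod.fst) +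
      bandMass p a e'.2 + runSum p a (L.map Prod.fst) := by
  have hmass' : bandMass p a e'.2 = e'.1.g := hA.bandMass_eq (by simp) he'.le
  have hg' : 0 < e'.1.g := by
    rw [← hA.card e' (by simp)]
    exact Multiset.card_pos_iff_exists_mem.2 ⟨_, hA.own e' (by simp)⟩
  refine max_le (by omega) ?_
  rcases Nat.eq_zero_or_pos a with rfl | ha
  · simp
  have hΔ' : e'.1.Δ + 2 ^ (a - 1) ≤ p := add_le_of_lt_band (by omega)
  -- If the run is empty, the merge of `e'` into `e` was refused. Otherwise the merge of the nearest
  -- run tuple was, and its descendants end before `e'`, whose band is larger.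
  have key : m ≤ gSum (run.map Prod.fst) + e'.1.g + runSum p a (L.map Prod.fst) +
      (e.1.g + e.1.Δ) := by
    obtain ⟨f, L', rfl⟩ := List.exists_cons_of_ne_nil hL
    cases run with
    | nil =>
      have := hc.1 (by rw [he']; exact he)
      rw [he'] at this
      simp only [List.map_nil, gSum_nil, List.map_cons] at this ⊢
      omega
    | cons r run =>
      have hr := hrun r (by simp)
      have h2 : (e :: r :: run ++ e' :: f :: L').map Prod.fst =
        e.1 :: r.1 :: (run.map Prod.fst ++ e'.1 :: f.1 :: L'.map Prod.fst) := by simp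
      rw [h2] at hc
      obtain ⟨t', rest, ht'⟩ : ∃ t' rest, run.map Prod.fst ++ e'.1 :: f.1 :: L'.map Prod.fst =
          t' :: rest := List.exists_cons_of_ne_nil (by simp)
      have h3 : band p r.1.Δ ≤ band p e.1.Δ → m ≤ r.1.g + runSum p (band p r.1.Δ)
          (run.map Prod.fst ++ e'.1 :: f.1 :: L'.map Prod.fst) + e.1.g + e.1.Δ := by
        rw [ht'] at hc ⊢
        exact hc.1
      have h4 := h3 (by omega)
      have h5 := runSum_append_le p (band p r.1.Δ) (run.map Prod.fst)
        (e'.1 :: f.1 :: L'.map Prod.fst)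
      rw [runSum_cons, if_neg (by omega)] at h5
      simp only [List.map_cons, gSum_cons]
      omega
  -- If `e` is in band `a`, all its weight counts as mass and `e.Δ` is at most `p - 2^(a-1)`. If its
  -- band is larger, its old elements do not count. `LowBounded` at the lower end `T` of band `a`
  -- bounds their number plus `e.Δ` by `e'.Δ + 1`, hence by `p - 2^(a-1) + 1`.
  rcases he.eq_or_lt with heq | hlt
  · have h1 : bandMass p a e.2 = e.1.g := hA.bandMass_eq (by simp) heq.ge
    have h2 : e.1.Δ + 2 ^ (a - 1) ≤ p := add_le_of_lt_band (by omega)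
    omega
  · have hp : 2 ^ a ≤ p := by
      by_contra hcon
      have := band_le_of_lt (p := p) (d := e.1.Δ) (not_le.1 hcon)
      omega
    obtain ⟨T, hT, -, -, hiff⟩ := exists_isThreshold hp
    have h1 := hlow T hT
    have h2 : (e :: run ++ e' :: L).reverse ++ R =
      L.reverse ++ (e' :: (run.reverse ++ e :: R)) := by simp
    rw [h2] at h1
    have h3 := h1.of_append.1 ((hiff _).1 he'.le)
    rw [firstLow_append_of_lt fun r hr => (hiff _).1 (hrun r (List.mem_reverse.1 hr)).le,
      firstLow, if_neg fun h => absurd ((hiff _).2 h) (by omega)] at h3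
    have h4 : bandMass p a e.2 = e.2.countP (T < ·) := by
      unfold bandMass
      exact Multiset.countP_congr rfl fun d _ => propext (hiff d)
    have h5 := Multiset.card_eq_countP_add_countP (T < ·) e.2
    have h6 : e.2.countP (fun d => ¬ T < d) = e.2.countP (· ≤ T) :=
      Multiset.countP_congr rfl fun d _ => propext not_lt
    rw [hA.card e (by simp)] at h5
    omega

/-- Add `le_of_isCompressed` over consecutive tuples of band at least `a`. The run left of `e'` is
used by the pair `(e, e')` and again by the next pair. Carrying `runSum` on the left side of the
induction keeps track of this, so no element is charged more than twice. -/
theorem countP_band_mul_le {p m a : ℕ} (hpm : p ≤ m) {e : GKTuple 𝒳 × Multiset ℕ}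
    {L R : AnnSketch 𝒳} (hA : AnnCorrect p (e :: L))
    (hc : IsCompressed p m ((e :: L).map Prod.fst))
    (hlow : ∀ T, IsThreshold p T → LowBounded T ((e :: L).reverse ++ R))
    (he : a ≤ band p e.1.Δ) :
    L.countP (fun r => decide (band p r.1.Δ = a)) * max 1 (2 ^ (a - 1) - 1) +
      runSum p a (L.map Prod.fst) ≤
      bandMass p a e.2 + 2 * bandMass p a (merged L) + max 1 (2 ^ (a - 1) - 1) := by
  induction hn : L.length using Nat.strong_induction_on generalizing e L R with
  | _ n ih =>
  set M := max 1 (2 ^ (a - 1) - 1) with hM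
  rcases exists_first_or_forall (fun r : GKTuple 𝒳 × Multiset ℕ => a ≤ band p r.1.Δ) L with
    h | ⟨run, e', L', rfl, hrun, he'⟩
  · have h1 : L.countP (fun r => decide (band p r.1.Δ = a)) = 0 := by
      rw [List.countP_eq_zero]
      intro r hr hr'
      have h2 := h r hr
      have h3 := of_decide_eq_true hr'
      omega
    have h2 := runSum_le_bandMass (b := a) (hA.of_subset (List.subset_cons_self e L))
    rw [h1]
    omega
  · have hcount : run.countP (fun r => decide (band p r.1.Δ = a)) = 0 := by
      rw [List.countP_eq_zero]
      intro r hr hr'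
      have h2 := hrun r hr
      have h3 := of_decide_eq_true hr'
      omega
    have hrun' : ∀ r ∈ run, band p r.1.Δ < a := fun r hr => not_le.1 (hrun r hr)
    have hmassrun : bandMass p a (merged run) = gSum (run.map Prod.fst) :=
      (hA.of_subset fun r hr => by simp [hr]).bandMass_merged fun r hr => (hrun' r hr).le
    have hrunSum : runSum p a ((run ++ e' :: L').map Prod.fst) = gSum (run.map Prod.fst) := by
      rw [List.map_append, runSum_append_of_lt, List.map_cons, runSum_cons,
        if_neg (not_lt.2 he'), add_zero]
      intro t ht
      obtain ⟨r, hr, rfl⟩ := List.mem_map.1 ht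
      exact hrun' r hr
    have hI := ih L'.length (by rw [← hn]; simp; omega) (e := e') (L := L')
      (R := run.reverse ++ e :: R) (hA.of_subset fun r hr => by
        rcases List.mem_cons.1 hr with rfl | hr <;> simp [*])
      (by
        have h1 : (e :: (run ++ e' :: L')).map Prod.fst =
          (e.1 :: run.map Prod.fst) ++ (e' :: L').map Prod.fst := by simp
        rw [h1] at hc
        exact hc.of_append)
      (fun T hT => by simpa using hlow T hT) he' rfl
    rw [hrunSum, List.countP_append, hcount, zero_add, List.countP_cons, merged_append,
      merged_cons, bandMass_add, bandMass_add, hmassrun]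
    by_cases hb : band p e'.1.Δ = a
    · simp only [hb, decide_true, if_true, add_mul, one_mul]
      -- The first tuple of the sketch is never deleted, so no refused merge pays for it. The spare
      -- summand `M` does.
      by_cases hL' : L' = []
      · subst hL'
        simp
        omega
      · have hkey := le_of_isCompressed (R := R) hpm hA hc hlow he hrun' hb hL'
        rw [← hM] at hkey
        omega
    · simp only [hb, decide_false, Bool.false_eq_true, if_false, add_zero]
      omega

/-- The second spare `M` pays for the rightmost tuple of band at least `a`, which is not the left
member of any pair. -/
theorem countP_band_mul_le_of_bandInv {α : ℝ} {m a : ℕ} {A : AnnSketch 𝒳} (h : BandInv α m A)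
    (hc : IsCompressed ⌊2 * α * (m : ℝ)⌋₊ ⌈2 * α * (m : ℝ)⌉₊ (A.map Prod.fst).reverse) :
    A.countP (fun r => decide (band ⌊2 * α * (m : ℝ)⌋₊ r.1.Δ = a)) *
      max 1 (2 ^ (a - 1) - 1) ≤
      2 * bandMass ⌊2 * α * (m : ℝ)⌋₊ a (merged A) + 2 * max 1 (2 ^ (a - 1) - 1) := by
  set p := ⌊2 * α * (m : ℝ)⌋₊ with hp
  set M := max 1 (2 ^ (a - 1) - 1) with hM
  have hA : AnnCorrect p A := ⟨h.card, h.own, h.le⟩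
  have hrev : A.countP (fun r => decide (band p r.1.Δ = a)) =
      A.reverse.countP (fun r => decide (band p r.1.Δ = a)) := by
    rw [List.countP_reverse]
  rcases exists_first_or_forall (fun r : GKTuple 𝒳 × Multiset ℕ => a ≤ band p r.1.Δ) A.reverse
    with h0 | ⟨run, e, L, heq, hrun, he⟩
  · have h1 : A.reverse.countP (fun r => decide (band p r.1.Δ = a)) = 0 := by
      rw [List.countP_eq_zero]
      intro r hr hr'
      have h2 := h0 r hr
      have h3 := of_decide_eq_true hr'
      omega
    rw [hrev, h1]
    omega
  · have hcount : run.countP (fun r => decide (band p r.1.Δ = a)) = 0 := by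
      rw [List.countP_eq_zero]
      intro r hr hr'
      have h2 := hrun r hr
      have h3 := of_decide_eq_true hr'
      omega
    have hAeq : A = (e :: L).reverse ++ run.reverse := by
      rw [← List.reverse_reverse A, heq]; simp
    have h1 := countP_band_mul_le (p := p) (a := a) (m := ⌈2 * α * (m : ℝ)⌉₊) (R := run.reverse)
      (Nat.floor_le_ceil _) (hA.of_subset (B := e :: L) fun r hr => by
        rw [hAeq]
        exact List.mem_append_left _ (List.mem_reverse.2 hr))
      (by
        rw [← List.map_reverse, heq, List.map_append] at hc
        exact hc.of_append)
      (fun T hT => by rw [← hAeq]; exact h.low T hT) he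
    rw [← hM] at h1
    have h2 : bandMass p a (merged A) =
        bandMass p a e.2 + bandMass p a (merged L) + bandMass p a (merged run) := by
      have : merged A = merged A.reverse := by simp [merged, List.sum_reverse]
      rw [this, heq]
      simp; ring
    have h3 : (if decide (band p e.1.Δ = a) = true then 1 else 0) ≤ 1 := by split_ifs <;> simp
    rw [hrev, heq, List.countP_append, hcount, zero_add, List.countP_cons, add_mul, h2]
    have h4 := Nat.mul_le_mul_right M h3
    omega

/-- Band at most `a` means an initial `Δ` above the lower end `T`, where `p < T + 2 * 2^a`. As `Δ`
is at most `⌊2αj⌋` at insertion time `j`, such an element is among the last `2^a / α` ones. If `2^a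
> p`, the whole stream is that short. -/
theorem bandMass_merged_le {α : ℝ} (hα : 0 < α) {m a : ℕ} {A : AnnSketch 𝒳}
    (h : BandInv α m A) (htot : gSum (A.map Prod.fst) = m) :
    (bandMass ⌊2 * α * (m : ℝ)⌋₊ a (merged A) : ℝ) ≤ 2 ^ a / α := by
  set p := ⌊2 * α * (m : ℝ)⌋₊ with hp
  have hfl : 2 * α * m < p + 1 := Nat.lt_floor_add_one _
  rw [le_div_iff₀ hα]
  by_cases hpa : 2 ^ a ≤ p
  · obtain ⟨T, hT, hTp, hpT, hiff⟩ := exists_isThreshold hpa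
    have h1 : bandMass p a (merged A) = (merged A).countP (T < ·) := by
      unfold bandMass
      exact Multiset.countP_congr rfl fun d _ => propext (hiff d)
    have h2 := h.count T
    rw [← h1] at h2
    set k := ⌊(2 : ℝ) ^ a / α⌋₊ with hk
    have h3 : ((Finset.range m).filter fun j : ℕ => T < ⌊2 * α * (j : ℝ)⌋₊) ⊆
        Finset.Ico (m - k) m := by
      intro j hj
      obtain ⟨hj1, hj2⟩ := Finset.mem_filter.1 hj
      rw [Finset.mem_range] at hj1
      rw [Finset.mem_Ico]
      refine ⟨?_, hj1⟩
      have h4 : ((T + 1 : ℕ) : ℝ) ≤ 2 * α * j := (Nat.le_floor_iff (by positivity)).1 hj2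
      have h5 : (p : ℝ) + 1 ≤ T + 2 * 2 ^ a := by exact_mod_cast hpT
      push_cast at h4
      have h6 : ((m - j : ℕ) : ℝ) ≤ 2 ^ a / α := by
        rw [le_div_iff₀ hα, Nat.cast_sub hj1.le]
        nlinarith
      have := Nat.le_floor h6
      omega
    have h4 := (Finset.card_le_card h3)
    rw [Nat.card_Ico] at h4
    have h5 : bandMass p a (merged A) ≤ k := by omega
    have h6 : (k : ℝ) ≤ 2 ^ a / α := Nat.floor_le (by positivity)
    have h7 : (bandMass p a (merged A) : ℝ) ≤ k := by exact_mod_cast h5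
    rw [← le_div_iff₀ hα]
    exact h7.trans h6
  · have h1 : bandMass p a (merged A) ≤ m := by
      rw [← htot, ← card_merged h.card]
      exact Multiset.countP_le_card _ _
    have h2 : (bandMass p a (merged A) : ℝ) ≤ m := by exact_mod_cast h1
    have h3 : (p : ℝ) + 1 ≤ 2 ^ a := by exact_mod_cast not_le.1 hpa
    have h4 : (bandMass p a (merged A) : ℝ) * α ≤ m * α := by gcongr
    have h5 : (0 : ℝ) ≤ m * α := by positivity
    linarith

/-- Since `2^a ≤ 4M`, dividing the charging bound by `M` leaves at most `8/α + 2 ≤ 10/α` tuples per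
band, and bands do not exceed `Nat.size p`. -/
theorem length_le_of_bandInv {α : ℝ} (hα : 0 < α) (hα1 : α ≤ 1) {m : ℕ} {A : AnnSketch 𝒳}
    (h : BandInv α m A) (htot : gSum (A.map Prod.fst) = m)
    (hc : IsCompressed ⌊2 * α * (m : ℝ)⌋₊ ⌈2 * α * (m : ℝ)⌉₊ (A.map Prod.fst).reverse) :
    (A.length : ℝ) ≤ 10 / α * (Nat.size ⌊2 * α * (m : ℝ)⌋₊ + 1) := by
  set p := ⌊2 * α * (m : ℝ)⌋₊ with hp
  have hcount : ∀ a, (A.countP (fun r => decide (band p r.1.Δ = a)) : ℝ) ≤ 10 / α := by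
    intro a
    have h1 := countP_band_mul_le_of_bandInv (a := a) h hc
    have h2 := bandMass_merged_le (a := a) hα h htot
    rw [← hp] at h1 h2
    set M := max 1 (2 ^ (a - 1) - 1) with hM
    have hM4 : (2 : ℝ) ^ a ≤ 4 * M := by
      have : 2 ^ a ≤ 4 * M := by
        have hm1 : 1 ≤ M := le_max_left _ _
        have hm2 : 2 ^ (a - 1) - 1 ≤ M := le_max_right _ _
        match a, hm2 with
        | 0, _ => omega
        | b + 1, hm2 =>
          have : 2 ^ (b + 1) = 2 * 2 ^ b := by ring
          simp only [Nat.add_sub_cancel] at hm2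
          omega
      exact_mod_cast this
    have hMpos : (0 : ℝ) < M := by
      have : 0 < M := lt_of_lt_of_le one_pos (le_max_left _ _)
      exact_mod_cast this
    have h3 : (A.countP (fun r => decide (band p r.1.Δ = a)) : ℝ) * M ≤
        2 * (bandMass p a (merged A) : ℝ) + 2 * M := by exact_mod_cast h1
    have h4 : (2 : ℝ) ^ a / α ≤ 4 * M / α := by gcongr
    have h5 : (2 : ℝ) * M ≤ 2 * M / α := by
      rw [le_div_iff₀ hα]
      nlinarith
    refine le_of_mul_le_mul_right ?_ hMpos
    calc _ ≤ 2 * (bandMass p a (merged A) : ℝ) + 2 * M := h3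
      _ ≤ 2 * (4 * M / α) + 2 * M / α := by linarith
      _ = 10 / α * M := by ring
  rw [length_eq_sum_countP (fun r => band p r.1.Δ) (Nat.size p + 1) A fun r _ =>
    Nat.lt_succ_of_le (band_le_of_lt (Nat.lt_size_self p))]
  push_cast
  refine (Finset.sum_le_card_nsmul _ _ _ fun a _ => hcount a).trans ?_
  rw [Finset.card_range, nsmul_eq_mul]
  push_cast
  linarith

theorem length_le_of_compressed [LinearOrder 𝒳] {α : ℝ} (hα : 0 < α) (hα1 : α ≤ 1) (xs : List 𝒳)
    (h : 1 / (2 * α) ≤ (xs.length : ℝ)) :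
    ((compress α xs.length (readAll α xs).sketch).length : ℝ) ≤
      10 / α * (Nat.size ⌊2 * α * (xs.length : ℝ)⌋₊ + 1) := by
  have h1 : RankInv α xs (compress α xs.length (readAll α xs).sketch) ∧
      HasBandInv α xs.length (compress α xs.length (readAll α xs).sketch) :=
    compress_induction (P := fun S => RankInv α xs S ∧ HasBandInv α xs.length S)
      (fun _ _ _ _ _ hd h => ⟨(h.1.deletion hd).2, hasBandInv_deletion hd h.1 h.2⟩) _
      ⟨rankInv_readAll hα xs, hasBandInv_readAll hα xs⟩
  have hc := isCompressed_compress (S := (readAll α xs).sketch) h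
  obtain ⟨h1, A, hA, hinv⟩ := h1
  rw [← hA] at hc ⊢
  rw [List.length_map]
  exact length_le_of_bandInv hα hα1 hinv (by rw [hA]; exact h1.total) hc

theorem length_insert [LinearOrder 𝒳] (α : ℝ) (m : ℕ) (x : 𝒳) (S : List (GKTuple 𝒳)) :
    (insert α m x S).length = S.length + 1 := by
  have := congrArg List.length
    (List.takeWhile_append_dropWhile (p := fun t : GKTuple 𝒳 => decide (t.val ≤ x)) (l := S))
  simp only [List.length_append] at this
  simp only [insert, List.length_append, List.length_cons]
  omega

theorem RankInv.length_le [LinearOrder 𝒳] {α : ℝ} {xs : List 𝒳} {S : List (GKTuple 𝒳)}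
    (h : RankInv α xs S) : S.length ≤ xs.length := by
  rw [← h.total, gSum]
  have := List.card_nsmul_le_sum (S.map GKTuple.g) 1 fun g hg => by
    obtain ⟨t, ht, rfl⟩ := List.mem_map.1 hg
    exact h.pos t ht
  simpa using this

/-- The remainder counts insertions since the last scheduled compression, and the final 1 is the
insertion right after it. While `m < 1/(2α)` compress does nothing, but the sketch then has at most
`m` tuples. -/
theorem length_sketch_le [LinearOrder 𝒳] {α : ℝ} (hα : 0 < α) (hα1 : α ≤ 1) (xs : List 𝒳) :
    ((readAll α xs).sketch.length : ℝ) ≤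
      10 / α * (Nat.size ⌊2 * α * (xs.length : ℝ)⌋₊ + 1) +
        (xs.length % ⌈1 / (2 * α)⌉₊ : ℕ) + 1 := by
  induction xs using List.reverseRecOn with
  | nil => simp [readAll, Memory.init]; positivity
  | append_singleton xs x ih =>
    have hmono : Nat.size ⌊2 * α * (xs.length : ℝ)⌋₊ ≤
        Nat.size ⌊2 * α * ((xs ++ [x]).length : ℝ)⌋₊ :=
      Nat.size_le_size (floor_mono hα (by simp))
    have hmono' : 10 / α * ((Nat.size ⌊2 * α * (xs.length : ℝ)⌋₊ : ℝ) + 1) ≤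
        10 / α * (Nat.size ⌊2 * α * ((xs ++ [x]).length : ℝ)⌋₊ + 1) := by
      have : (Nat.size ⌊2 * α * (xs.length : ℝ)⌋₊ : ℝ) ≤
        Nat.size ⌊2 * α * ((xs ++ [x]).length : ℝ)⌋₊ := by exact_mod_cast hmono
      gcongr
    have hk : 0 < ⌈1 / (2 * α)⌉₊ := Nat.ceil_pos.2 (by positivity)
    rw [readAll_sketch_append_singleton]
    unfold update
    rw [length_insert]
    have hlen : (xs ++ [x]).length = xs.length + 1 := by simp
    split_ifs with hmod
    · rw [hlen] at hmono' ⊢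
      rw [hmod]
      push_cast at hmono' ⊢
      by_cases hm : 1 / (2 * α) ≤ (xs.length : ℝ)
      · have := length_le_of_compressed hα hα1 xs hm
        linarith
      · have h1 := (rankInv_readAll hα xs).length_le
        have h2 : compress α xs.length (readAll α xs).sketch = (readAll α xs).sketch := by
          unfold compress
          rw [if_pos (not_le.1 hm)]
        rw [h2]
        have h3 : ((readAll α xs).sketch.length : ℝ) ≤ xs.length := by exact_mod_cast h1
        have h4 : 1 / (2 * α) ≤ 10 / α := by
          rw [div_le_div_iff₀ (by positivity) hα]; linarith
        have h5 : 10 / α * 1 ≤ 10 / α * ((Nat.size ⌊2 * α * ((xs.length : ℝ) + 1)⌋₊ : ℝ) + 1) := by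
          gcongr
          simp
        linarith
    · have h1 : (xs ++ [x]).length % ⌈1 / (2 * α)⌉₊ = xs.length % ⌈1 / (2 * α)⌉₊ + 1 := by
        rw [hlen]
        have h2 := Nat.mod_lt xs.length hk
        have h3 := Nat.div_add_mod xs.length ⌈1 / (2 * α)⌉₊
        have h4 : (xs.length + 1) % ⌈1 / (2 * α)⌉₊ =
            (xs.length % ⌈1 / (2 * α)⌉₊ + 1) % ⌈1 / (2 * α)⌉₊ := by simp
        rcases Nat.lt_or_ge (xs.length % ⌈1 / (2 * α)⌉₊ + 1) ⌈1 / (2 * α)⌉₊ with h5 | h5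
        · rw [h4, Nat.mod_eq_of_lt h5]
        · have h6 : xs.length % ⌈1 / (2 * α)⌉₊ + 1 = ⌈1 / (2 * α)⌉₊ := by omega
          rw [h6, Nat.mod_self] at h4
          exact absurd h4 hmod
      rw [h1]
      push_cast at hmono' ⊢
      linarith

theorem size_le_log {y : ℝ} (hy : 1 ≤ y) : (Nat.size ⌊y⌋₊ : ℝ) ≤ 1 + Real.log y / Real.log 2 := by
  have h1 : ⌊y⌋₊ ≠ 0 := (Nat.floor_pos.2 hy).ne'
  obtain ⟨k, hk⟩ : ∃ k, Nat.size ⌊y⌋₊ = k + 1 :=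
    ⟨Nat.size ⌊y⌋₊ - 1, by have := Nat.size_pos.2 (Nat.pos_of_ne_zero h1); omega⟩
  have h2 : 2 ^ k ≤ ⌊y⌋₊ := Nat.lt_size.1 (by omega)
  have h3 : (2 : ℝ) ^ k ≤ y := by
    have : ((2 ^ k : ℕ) : ℝ) ≤ y := (Nat.le_floor_iff (by linarith)).1 h2
    simpa using this
  have h4 : (k : ℝ) * Real.log 2 ≤ Real.log y := by
    rw [← Real.log_pow]
    exact Real.log_le_log (by positivity) h3
  rw [hk]
  push_cast
  have := (le_div_iff₀ (Real.log_pos one_lt_two)).2 h4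
  linarith

/-- The size of a sketch is `O((1 / α) max (1, log (α n)))`. -/
theorem length_sketch_le_log [LinearOrder 𝒳] {α : ℝ} (hα : 0 < α) (hα1 : α ≤ 1) (xs : List 𝒳) :
    ((readAll α xs).sketch.length : ℝ) ≤
      60 * (1 / α * max 1 (Real.log (α * xs.length))) := by
  have h1 := length_sketch_le hα hα1 xs
  have hk : 0 < ⌈1 / (2 * α)⌉₊ := Nat.ceil_pos.2 (by positivity)
  have h2 : ((xs.length % ⌈1 / (2 * α)⌉₊ : ℕ) : ℝ) ≤ ⌈1 / (2 * α)⌉₊ := by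
    exact_mod_cast (Nat.mod_lt _ hk).le
  have h3 := Nat.ceil_lt_add_one (show (0 : ℝ) ≤ 1 / (2 * α) by positivity)
  have h4 : (1 : ℝ) ≤ 1 / α := by rw [le_div_iff₀ hα]; linarith
  have h5 : 1 / (2 * α) = 1 / 2 * (1 / α) := by field_simp
  set W := max 1 (Real.log (α * xs.length)) with hW
  have hW1 : 1 ≤ W := le_max_left _ _
  have h6 : (Nat.size ⌊2 * α * (xs.length : ℝ)⌋₊ : ℝ) ≤ 4 * W := by
    by_cases hy : 1 ≤ 2 * α * (xs.length : ℝ)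
    · refine (size_le_log hy).trans ?_
      have h7 : 0 < α * (xs.length : ℝ) := by nlinarith
      have h8 : Real.log (2 * α * xs.length) = Real.log 2 + Real.log (α * xs.length) := by
        rw [mul_assoc, Real.log_mul two_ne_zero h7.ne']
      have h9 : Real.log (α * xs.length) ≤ W := le_max_right _ _
      have h10 := Real.log_two_gt_d9
      rw [h8, add_div, div_self (by positivity)]
      have h11 : Real.log (α * xs.length) / Real.log 2 ≤ 2 * W := by
        rw [div_le_iff₀ (by positivity)]
        nlinarith
      linarith
    · rw [Nat.floor_eq_zero.2 (not_le.1 hy)]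
      simp; linarith
  have h7 : 10 / α * ((Nat.size ⌊2 * α * (xs.length : ℝ)⌋₊ : ℝ) + 1) ≤
      10 / α * (5 * W) := by
    gcongr
    linarith
  have h8 : 10 / α * (5 * W) = 50 * (1 / α * W) := by ring
  have h9 : 1 / α ≤ 1 / α * W := le_mul_of_one_le_right (by positivity) hW1
  linarith

end Space

/-! ## Rank estimates -/

section Estimates

variable {𝒳 : Type u} [LinearOrder 𝒳]

theorem prefixG_append_length {𝒳 : Type u} (l r : List (GKTuple 𝒳)) :
    prefixG (l ++ r) l.length = gSum l := by
  simp [prefixG, gSum]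

theorem prefixG_mono {𝒳 : Type u} (S : List (GKTuple 𝒳)) : Monotone (prefixG S) := by
  intro j k h
  exact ((List.take_sublist_take_left h).map _).sum_le_sum fun _ _ => Nat.zero_le _

theorem upper_eq {𝒳 : Type u} {l r : List (GKTuple 𝒳)} {t : GKTuple 𝒳}
    (i : Fin (l ++ t :: r).length) (hi : (i : ℕ) = l.length) :
    upper (l ++ t :: r) i = gSum l + t.g + t.Δ := by
  have h1 : (l ++ t :: r).get i = t := by simp [hi]
  have h2 : prefixG (l ++ t :: r) (i + 1) = gSum l + t.g := by
    have := prefixG_append_length (l ++ [t]) r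
    simpa [hi] using this
  rw [upper, h1, h2]
  ring

theorem get_iff_lt_length {𝒳 : Type u} {l r : List (GKTuple 𝒳)} {P : 𝒳 → Prop} (hl : ∀ t ∈ l, P t.val)
    (hr : ∀ t ∈ r, ¬ P t.val) (i : Fin (l ++ r).length) :
    P ((l ++ r).get i).val ↔ (i : ℕ) < l.length := by
  rw [List.get_eq_getElem, List.getElem_append]
  split_ifs with h
  · exact iff_of_true (hl _ (List.getElem_mem _)) h
  · exact iff_of_false (hr _ (List.getElem_mem _)) h

theorem le_minUpper {𝒳 : Type u} {S : List (GKTuple 𝒳)} {I : Finset (Fin S.length)} {B : ℕ} :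
    B ≤ minUpper S I ↔ B ≤ gSum S + 1 ∧ ∀ i ∈ I, B ≤ upper S i := by
  have h : prefixG S S.length = gSum S := by simp [prefixG, gSum]
  rw [minUpper, Finset.le_min'_iff, h]
  simp

theorem val_le_val {S : List (GKTuple 𝒳)} (hS : S.Pairwise fun s t => s.val ≤ t.val) {i j : Fin S.length}
    (h : i ≤ j) : (S.get i).val ≤ (S.get j).val := by
  rcases h.eq_or_lt with rfl | h
  · exact le_rfl
  · exact List.pairwise_iff_get.1 hS i j h

/-- A sorted sketch splits at every value. -/
theorem exists_split {S : List (GKTuple 𝒳)} (hS : S.Pairwise fun s t => s.val ≤ t.val)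
    (P : 𝒳 → Prop) (hP : ∀ y z, y ≤ z → P z → P y) :
    ∃ l r, S = l ++ r ∧ (∀ t ∈ l, P t.val) ∧ ∀ t ∈ r, ¬ P t.val := by
  rcases exists_first_or_forall (fun t : GKTuple 𝒳 => ¬ P t.val) S with h | ⟨l, s, r, rfl, h1, h2⟩
  · exact ⟨S, [], by simp, fun t ht => not_not.1 (h t ht), by simp⟩
  · refine ⟨l, s :: r, rfl, fun t ht => not_not.1 (h1 t ht), fun t ht => ?_⟩
    rcases List.mem_cons.1 ht with rfl | ht
    · exact h2
    · exact fun h => h2 (hP _ _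
        (List.rel_of_pairwise_cons (List.pairwise_append.1 hS).2.1 ht) h)

theorem rHatMin_eq_prefixG {S : List (GKTuple 𝒳)} {x : 𝒳} {k : ℕ} (hk : k ≤ S.length)
    (h : ∀ i : Fin S.length, (S.get i).val < x ↔ (i : ℕ) < k) : rHatMin S x = prefixG S k := by
  refine le_antisymm (Finset.sup_le fun i hi => ?_) ?_
  · exact prefixG_mono S ((h i).1 (Finset.mem_filter.1 hi).2)
  · rcases Nat.eq_zero_or_pos k with rfl | hk0
    · simp [prefixG]
    · have hlt : k - 1 < S.length := by omega
      have h1 : prefixG S ((⟨k - 1, hlt⟩ : Fin S.length) + 1) ≤ rHatMin S x :=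
        Finset.le_sup (f := fun i : Fin S.length => prefixG S (i + 1))
          (Finset.mem_filter.2 ⟨Finset.mem_univ _, (h ⟨k - 1, hlt⟩).2 (by simp; omega)⟩)
      simpa [Nat.sub_add_cancel hk0] using h1

theorem rHatMin_append {l r : List (GKTuple 𝒳)} {x : 𝒳} (hl : ∀ t ∈ l, t.val < x)
    (hr : ∀ t ∈ r, ¬ t.val < x) : rHatMin (l ++ r) x = gSum l := by
  rw [rHatMin_eq_prefixG (k := l.length) (by simp) (get_iff_lt_length (P := (· < x)) hl hr),
    prefixG_append_length]

variable {α : ℝ} {xs : List 𝒳} {S : List (GKTuple 𝒳)}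

theorem RankInv.rHatMin_le (h : RankInv α xs S) (x : 𝒳) :
    rHatMin S x ≤ xs.countP fun y => decide (y < x) := by
  obtain ⟨l, r, rfl, hl, hr⟩ := exists_split h.sorted (· < x) fun y z h1 h2 => h1.trans_lt h2
  rw [rHatMin_append hl hr]
  exact (ranksCorrect_append.1 h.ranks).1.gSum_le fun t ht y hy => hy.trans_lt (hl t ht)

/-- The first tuple with value at least `x` has rank uncertainty `g + Δ ≤ ⌊2αn⌋ + 1`, which limits
what `rHatMin` can miss. -/
theorem RankInv.le_rHatMin (h : RankInv α xs S) (x : 𝒳) :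
    xs.countP (fun y => decide (y < x)) ≤ rHatMin S x + ⌊2 * α * (xs.length : ℝ)⌋₊ := by
  obtain ⟨l, r, rfl, hl, hr⟩ := exists_split h.sorted (· < x) fun y z h1 h2 => h1.trans_lt h2
  rw [rHatMin_append hl hr]
  cases r with
  | nil =>
    have h1 := h.total
    have h2 : xs.countP (fun y => decide (y < x)) ≤ xs.length := List.countP_le_length
    simp at h1
    omega
  | cons s r =>
    have h1 := (ranksCorrect_append.1 h.ranks).2.2.1
    have h2 : xs.countP (fun y => decide (y < x)) ≤ xs.countP (fun y => decide (y < s.val)) :=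
      countP_le_countP fun y hy => hy.trans_le (not_lt.1 (hr s (by simp)))
    have h3 := h.bound s (by simp)
    omega

/-- The extra 1 arises because `rHatMax` bounds the rank of an element strictly above `x`; the
sentinel at `n + 1` fits the same pattern. -/
theorem RankInv.lt_rHatMax (h : RankInv α xs S) (x : 𝒳) :
    xs.countP (fun y => decide (y ≤ x)) + 1 ≤ rHatMax S x := by
  rw [rHatMax, le_minUpper]
  refine ⟨?_, fun i hi => ?_⟩
  · rw [h.total]
    exact Nat.succ_le_succ List.countP_le_length
  · have hx : x < (S.get i).val := (Finset.mem_filter.1 hi).2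
    obtain ⟨l, t, r, heq, hlen⟩ : ∃ l t r, S = l ++ t :: r ∧ (i : ℕ) = l.length :=
      ⟨S.take i, S.get i, S.drop (i + 1), by simp, by simp⟩
    subst heq
    have hget : (l ++ t :: r).get i = t := by simp [hlen]
    rw [hget] at hx
    rw [upper_eq i hlen]
    have h1 := (ranksCorrect_append.1 h.ranks).2.2.1
    have h2 : xs.countP (fun y => decide (y ≤ x)) ≤ xs.countP (fun y => decide (y < t.val)) :=
      countP_le_countP fun y hy => hy.trans_lt hx
    omega

theorem RankInv.rHatMax_le (h : RankInv α xs S) (x : 𝒳) :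
    rHatMax S x ≤ xs.countP (fun y => decide (y ≤ x)) + ⌊2 * α * (xs.length : ℝ)⌋₊ + 1 := by
  have hle := (le_minUpper (S := S) (I := Finset.univ.filter fun i => x < (S.get i).val)).1
    (le_refl (rHatMax S x))
  obtain ⟨l, r, rfl, hl, hr⟩ := exists_split h.sorted (· ≤ x) fun y z h1 h2 => h1.trans h2
  have h0 := (ranksCorrect_append.1 h.ranks).1.gSum_le (P := (· ≤ x))
    fun t ht y hy => hy.trans (hl t ht)
  cases r with
  | nil =>
    have h1 := hle.1
    rw [List.append_nil] at h1 ⊢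
    omega
  | cons s r =>
    have hlen : l.length < (l ++ s :: r).length := by simp
    have h1 := hle.2 ⟨l.length, hlen⟩ (by
      simp only [Finset.mem_filter, Finset.mem_univ, true_and, List.get_eq_getElem]
      simpa using hr s (by simp))
    rw [upper_eq _ rfl] at h1
    have h3 := h.bound s (by simp)
    omega

end Estimates

/-! ### Rank estimates for streams, and ranks of neighbouring streams -/

section Streams

variable {𝒳 : Type u} [LinearOrder 𝒳] {n : ℕ}

theorem countP_ofFn {ι : Type*} (X : Fin n → ι) (P : ι → Prop) [DecidablePred P] :
    (List.ofFn X).countP (fun y => decide (P y)) =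
      (Finset.univ.filter fun i => P (X i)).card := by
  induction n with
  | zero => simp
  | succ n ih =>
    rw [List.ofFn_succ, List.countP_cons, ih, Fin.card_filter_univ_succ]
    by_cases h : P (X 0) <;> simp [h]

theorem rankInv_sketchOf {α : ℝ} (hα : 0 < α) (X : Fin n → 𝒳) :
    RankInv α (List.ofFn X) (sketchOf α X) := rankInv_readAll hα (List.ofFn X)

theorem rHatMin_le_rankMin {α : ℝ} (hα : 0 < α) (X : Fin n → 𝒳) (x : 𝒳) : rHatMin (sketchOf α X) x ≤ rankMin X x := by
  have := (rankInv_sketchOf hα X).rHatMin_le x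
  rwa [countP_ofFn X (· < x)] at this

theorem rankMin_le_rHatMin_add {α : ℝ} (hα : 0 < α) (X : Fin n → 𝒳) (x : 𝒳) :
    rankMin X x ≤ rHatMin (sketchOf α X) x + ⌊2 * α * (n : ℝ)⌋₊ := by
  have := (rankInv_sketchOf hα X).le_rHatMin x
  rwa [countP_ofFn X (· < x), List.length_ofFn] at this

theorem rankMax_lt_rHatMax {α : ℝ} (hα : 0 < α) (X : Fin n → 𝒳) (x : 𝒳) : rankMax X x + 1 ≤ rHatMax (sketchOf α X) x := by
  have := (rankInv_sketchOf hα X).lt_rHatMax x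
  rwa [countP_ofFn X (· ≤ x)] at this

theorem rHatMax_le_rankMax_add {α : ℝ} (hα : 0 < α) (X : Fin n → 𝒳) (x : 𝒳) :
    rHatMax (sketchOf α X) x ≤ rankMax X x + ⌊2 * α * (n : ℝ)⌋₊ + 1 := by
  have := (rankInv_sketchOf hα X).rHatMax_le x
  rwa [countP_ofFn X (· ≤ x), List.length_ofFn] at this

theorem rankMin_le_rankMax (X : Fin n → 𝒳) (x : 𝒳) : rankMin X x ≤ rankMax X x :=
  Finset.card_le_card (Finset.monotone_filter_right _ fun _ _ h => le_of_lt h)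

theorem rHatMin_le_rHatMax {α : ℝ} (hα : 0 < α) (X : Fin n → 𝒳) (x : 𝒳) : rHatMin (sketchOf α X) x ≤ rHatMax (sketchOf α X) x := by
  have h1 := rHatMin_le_rankMin hα X x
  have h2 := rankMin_le_rankMax X x
  have h3 := rankMax_lt_rHatMax hα X x
  omega

theorem card_filter_le_of_neighboring {X X' : Fin n → 𝒳} (h : Neighboring X X') (P : 𝒳 → Prop)
    [DecidablePred P] :
    (Finset.univ.filter fun i => P (X i)).card ≤
        (Finset.univ.filter fun i => P (X' i)).card + 1 ∧
      (Finset.univ.filter fun i => P (X' i)).card ≤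
        (Finset.univ.filter fun i => P (X i)).card + 1 := by
  obtain ⟨σ, hσ⟩ := h
  have h1 : (Finset.univ.filter fun i => P (X i)).card =
      (Finset.univ.filter fun i => P ((X ∘ σ) i)).card := by
    exact Finset.card_nbij' σ.symm σ (by intro i; simp) (by intro i; simp)
      (by intro i; simp) (by intro i; simp)
  have key : ∀ Y Y' : Fin n → 𝒳, hammingDist Y Y' ≤ 1 →
      (Finset.univ.filter fun i => P (Y i)).card ≤
        (Finset.univ.filter fun i => P (Y' i)).card + 1 := by
    intro Y Y' hY
    have h2 : (Finset.univ.filter fun i => P (Y i)) ⊆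
        (Finset.univ.filter fun i => P (Y' i)) ∪ Finset.univ.filter fun i => Y i ≠ Y' i := by
      intro i hi
      rw [Finset.mem_union, Finset.mem_filter, Finset.mem_filter]
      by_cases hne : Y i = Y' i
      · exact Or.inl ⟨Finset.mem_univ _, hne ▸ (Finset.mem_filter.1 hi).2⟩
      · exact Or.inr ⟨Finset.mem_univ _, hne⟩
    have h3 := (Finset.card_le_card h2).trans (Finset.card_union_le _ _)
    have h4 : (Finset.univ.filter fun i => Y i ≠ Y' i).card ≤ 1 := by
      simpa [hammingDist] using hY
    omega
  rw [h1]
  exact ⟨key _ _ hσ, key _ _ (by rwa [hammingDist_comm])⟩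

end Streams

/-! ## The cells of the selection phase -/

section Cells

variable {𝒳 : Type u} [LinearOrder 𝒳] [Fintype 𝒳] {S : List (GKTuple 𝒳)}

theorem mem_cell_of_lt {c : ℕ} (hc : c < S.length) {x : 𝒳} :
    x ∈ cell S c ↔ x = (S.get ⟨c, hc⟩).val ∧
      ∀ j : Fin S.length, (j : ℕ) < c → (S.get j).val ≠ x := by
  rw [cell, dif_pos hc]
  split_ifs with h
  · rw [Finset.mem_singleton]
    exact ⟨fun hx => ⟨hx, hx ▸ h⟩, fun hx => hx.1⟩
  · refine iff_of_false (Finset.notMem_empty x) ?_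
    rintro ⟨rfl, h'⟩
    exact h h'

theorem mem_cell_add (hS : S.Pairwise fun s t => s.val ≤ t.val) {k : ℕ} (hk : k ≤ S.length)
    {x : 𝒳} : x ∈ cell S (S.length + k) ↔
      ∀ j : Fin S.length, ((j : ℕ) < k → (S.get j).val < x) ∧
        (k ≤ (j : ℕ) → x < (S.get j).val) := by
  rw [cell, dif_neg (by omega), Nat.add_sub_cancel_left, gap, Finset.mem_filter]
  constructor
  · rintro ⟨-, h1, h2⟩ j
    constructor
    · intro hj
      refine lt_of_le_of_lt (val_le_val hS (j := ⟨k - 1, by omega⟩) ?_)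
        (h1 ⟨k - 1, by omega⟩ (by simp; omega))
      rw [Fin.le_def]; simp; omega
    · intro hj
      exact lt_of_lt_of_le (h2 ⟨k, by omega⟩ rfl) (val_le_val hS hj)
  · intro h
    exact ⟨Finset.mem_univ _, fun j hj => (h j).1 (by omega), fun j hj => (h j).2 hj.ge⟩

/-- Skipping repeated values matters here: `prefixG S c` adds up the tuples strictly below the value
of tuple `c` only if that value occurs there for the first time. -/
theorem iterMin_eq_rHatMin (hS : S.Pairwise fun s t => s.val ≤ t.val) {c : ℕ}
    (hc : c < 2 * S.length + 1) {x : 𝒳} (hx : x ∈ cell S c) : iterMin S c = rHatMin S x := by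
  rcases Nat.lt_or_ge c S.length with hlt | hge
  · obtain ⟨rfl, h2⟩ := (mem_cell_of_lt hlt).1 hx
    rw [iterMin, if_pos hlt, rHatMin_eq_prefixG hlt.le]
    intro i
    constructor
    · intro hi
      by_contra hcon
      exact absurd hi (not_lt.2 (val_le_val hS (i := ⟨c, hlt⟩) (not_lt.1 hcon)))
    · intro hi
      exact lt_of_le_of_ne (val_le_val hS (j := ⟨c, hlt⟩) hi.le) (h2 i hi)
  · obtain ⟨k, rfl⟩ := Nat.exists_eq_add_of_le hge
    have h := (mem_cell_add hS (by omega)).1 hx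
    rw [iterMin, if_neg (by omega), Nat.add_sub_cancel_left,
      rHatMin_eq_prefixG (show k ≤ S.length by omega)]
    intro i
    constructor
    · intro hi
      by_contra hcon
      exact absurd hi (not_lt.2 ((h i).2 (not_lt.1 hcon)).le)
    · exact (h i).1

theorem iterMax_eq_rHatMax (hS : S.Pairwise fun s t => s.val ≤ t.val) {c : ℕ}
    (hc : c < 2 * S.length + 1) {x : 𝒳} (hx : x ∈ cell S c) : iterMax S c = rHatMax S x := by
  rcases Nat.lt_or_ge c S.length with hlt | hge
  · obtain ⟨rfl, h2⟩ := (mem_cell_of_lt hlt).1 hx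
    rw [iterMax, dif_pos hlt, rHatMax]
  · obtain ⟨k, rfl⟩ := Nat.exists_eq_add_of_le hge
    have h := (mem_cell_add hS (by omega)).1 hx
    rw [iterMax, dif_neg (by omega), Nat.add_sub_cancel_left, rHatMax]
    congr 1
    refine Finset.filter_congr fun i _ => ⟨(h i).2, fun hi => ?_⟩
    by_contra hcon
    exact absurd hi (not_lt.2 ((h i).1 (not_le.1 hcon)).le)

theorem exists_mem_cell (hS : S.Pairwise fun s t => s.val ≤ t.val) (x : 𝒳) :
    ∃ c < 2 * S.length + 1, x ∈ cell S c := by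
  obtain ⟨l, r, rfl, hl, hr⟩ := exists_split hS (· < x) fun y z h1 h2 => h1.trans_lt h2
  have hiff := get_iff_lt_length (P := (· < x)) hl hr
  have hlen : l.length ≤ (l ++ r).length := by simp
  by_cases h : ∃ hk : l.length < (l ++ r).length, x = ((l ++ r).get ⟨l.length, hk⟩).val
  · obtain ⟨hk, hx⟩ := h
    exact ⟨l.length, by omega, (mem_cell_of_lt hk).2 ⟨hx, fun j hj => ((hiff j).2 hj).ne⟩⟩
  · refine ⟨(l ++ r).length + l.length, by omega, (mem_cell_add hS hlen).2 fun j =>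
      ⟨(hiff j).2, fun hj => ?_⟩⟩
    have hk : l.length < (l ++ r).length := hj.trans_lt j.2
    refine lt_of_lt_of_le (lt_of_le_of_ne (not_lt.1 fun h' => ?_) fun h' => h ⟨hk, h'⟩)
      (val_le_val hS (i := ⟨l.length, hk⟩) hj)
    exact absurd ((hiff ⟨l.length, hk⟩).1 h') (lt_irrefl _)

theorem cell_index_unique (hS : S.Pairwise fun s t => s.val ≤ t.val) {x : 𝒳} {c c' : ℕ}
    (hc : c < 2 * S.length + 1) (hc' : c' < 2 * S.length + 1) (hx : x ∈ cell S c)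
    (hx' : x ∈ cell S c') : c = c' := by
  wlog hle : c ≤ c' generalizing c c'
  · exact (this hc' hc hx' hx (le_of_not_ge hle)).symm
  by_contra hne
  have hlt : c < c' := lt_of_le_of_ne hle hne
  rcases Nat.lt_or_ge c S.length with h1 | h1
  · have hxc := ((mem_cell_of_lt h1).1 hx).1
    rcases Nat.lt_or_ge c' S.length with h2 | h2
    · exact ((mem_cell_of_lt h2).1 hx').2 ⟨c, h1⟩ hlt hxc.symm
    · obtain ⟨k, rfl⟩ := Nat.exists_eq_add_of_le h2
      have h := (mem_cell_add hS (by omega)).1 hx' ⟨c, h1⟩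
      rcases Nat.lt_or_ge c k with h3 | h3
      · exact (h.1 h3).ne hxc.symm
      · exact (h.2 h3).ne hxc
  · obtain ⟨k, rfl⟩ := Nat.exists_eq_add_of_le h1
    obtain ⟨k', rfl⟩ := Nat.exists_eq_add_of_le (h1.trans hle)
    have hk : k < S.length := by omega
    have h := (mem_cell_add hS (by omega)).1 hx ⟨k, hk⟩
    have h' := (mem_cell_add hS (by omega)).1 hx' ⟨k, hk⟩
    exact absurd (h.2 le_rfl) (not_lt.2 (h'.1 (by simp; omega)).le)

end Cells

/-! ## The distance to an interval -/

theorem distToInterval_eq (r : ℝ) {a b : ℕ} (hab : a ≤ b) :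
    distToInterval r a b = max 0 (max (a - r) (r - b)) := by
  have hab' : (a : ℝ) ≤ b := by exact_mod_cast hab
  have hne : (Set.Icc (a : ℝ) b).Nonempty := Set.nonempty_Icc.2 hab'
  unfold distToInterval
  refine le_antisymm ?_ ((Metric.le_infDist hne).2 fun y hy => ?_)
  · rcases lt_or_ge r a with h1 | h1
    · refine (Metric.infDist_le_dist_of_mem (show (a : ℝ) ∈ Set.Icc (a : ℝ) b from
        ⟨le_rfl, hab'⟩)).trans ?_
      rw [dist_comm, Real.dist_eq, abs_of_pos (by linarith)]
      exact le_max_of_le_right (le_max_left _ _)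
    · rcases lt_or_ge (b : ℝ) r with h2 | h2
      · refine (Metric.infDist_le_dist_of_mem (show (b : ℝ) ∈ Set.Icc (a : ℝ) b from
          ⟨hab', le_rfl⟩)).trans ?_
        rw [Real.dist_eq, abs_of_pos (by linarith)]
        exact le_max_of_le_right (le_max_right _ _)
      · rw [Metric.infDist_zero_of_mem (show r ∈ Set.Icc (a : ℝ) b from ⟨h1, h2⟩)]
        exact le_max_left _ _
  · rw [Real.dist_eq]
    refine max_le (abs_nonneg _) (max_le ?_ ?_)
    · have := neg_abs_le (r - y)
      linarith [hy.1]
    · have := le_abs_self (r - y)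
      linarith [hy.2]

/-- Only the moves that shrink the interval cost distance, so one inequality per endpoint is enough.
-/
theorem distToInterval_le_add {r D : ℝ} {a b a' b' : ℕ} (hab : a ≤ b) (hab' : a' ≤ b')
    (h1 : (a : ℝ) ≤ a' + D) (h2 : (b' : ℝ) ≤ b + D) (hD : 0 ≤ D) :
    distToInterval r a b ≤ distToInterval r a' b' + D := by
  rw [distToInterval_eq r hab, distToInterval_eq r hab']
  have h3 := le_max_left (0 : ℝ) (max (a' - r) (r - b'))
  have h4 := (le_max_left ((a' : ℝ) - r) (r - b')).trans (le_max_right 0 _)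
  have h5 := (le_max_right ((a' : ℝ) - r) (r - b')).trans (le_max_right 0 _)
  exact max_le (by linarith) (max_le (by linarith) (by linarith))

/-! ## The Gumbel distribution -/

section Gumbel

open Filter Topology Set

theorem hasDerivAt_exp_neg_mul_exp {K : ℝ} (hK : 0 < K) (z : ℝ) :
    HasDerivAt (fun z => Real.exp (-(K * Real.exp (-z))) / K)
      (Real.exp (-z) * Real.exp (-(K * Real.exp (-z)))) z := by
  have h1 : HasDerivAt (fun z : ℝ => Real.exp (-z)) (Real.exp (-z) * -1) z :=
    (hasDerivAt_neg z).exp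
  have h2 := ((h1.const_mul K).neg.exp).div_const K
  refine h2.congr_deriv ?_
  field_simp
  rfl

theorem hasDerivAt_neg_exp_neg_mul_exp {K : ℝ} (hK : 0 < K) (z : ℝ) :
    HasDerivAt (fun z => -(Real.exp (-(K * Real.exp z)) / K))
      (Real.exp z * Real.exp (-(K * Real.exp z))) z := by
  have h2 := ((((Real.hasDerivAt_exp z).const_mul K).neg.exp).div_const K).neg
  refine h2.congr_deriv ?_
  field_simp
  rfl

/-- The parameter `K` is kept because conditioning in the Gumbel-max trick multiplies the density by
another factor `exp (-(K * exp (-z)))`. Reflection turns the left half-line into a right one, where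
an antiderivative with limit 0 is at hand. -/
theorem setLIntegral_Iio_gumbel {K : ℝ} (hK : 0 < K) (t : ℝ) :
    ∫⁻ z in Iio t, ENNReal.ofReal (Real.exp (-z) * Real.exp (-(K * Real.exp (-z)))) =
      ENNReal.ofReal (Real.exp (-(K * Real.exp (-t))) / K) := by
  have h1 := (Measure.measurePreserving_neg (volume : Measure ℝ)).setLIntegral_comp_preimage_emb
    (MeasurableEquiv.neg ℝ).measurableEmbedding
    (fun z => ENNReal.ofReal (Real.exp (-z) * Real.exp (-(K * Real.exp (-z))))) (Iio t)
  rw [← h1]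
  have h2 : (Neg.neg ⁻¹' Iio t : Set ℝ) = Ioi (-t) := by
    ext z; simp
  rw [h2]
  simp only [neg_neg]
  have hlim : Tendsto (fun z => -(Real.exp (-(K * Real.exp z)) / K)) atTop (𝓝 0) := by
    have : Tendsto (fun z => Real.exp (-(K * Real.exp z))) atTop (𝓝 0) :=
      Real.tendsto_exp_neg_atTop_nhds_zero.comp
        (Real.tendsto_exp_atTop.const_mul_atTop hK)
    simpa using (this.div_const K).neg
  have h3 := integrableOn_Ioi_deriv_of_nonneg' (a := -t)
    (fun z _ => hasDerivAt_neg_exp_neg_mul_exp hK z) (fun z _ => by positivity) hlim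
  have h4 := integral_Ioi_of_hasDerivAt_of_nonneg' (a := -t)
    (fun z _ => hasDerivAt_neg_exp_neg_mul_exp hK z) (fun z _ => by positivity) hlim
  rw [← ofReal_integral_eq_lintegral_ofReal h3 (ae_of_all _ fun z => by positivity), h4]
  congr 1
  ring

theorem setLIntegral_Ioi_gumbel {K : ℝ} (hK : 0 < K) (t : ℝ) :
    ∫⁻ z in Ioi t, ENNReal.ofReal (Real.exp (-z) * Real.exp (-(K * Real.exp (-z)))) =
      ENNReal.ofReal (1 / K - Real.exp (-(K * Real.exp (-t))) / K) := by
  have hlim : Tendsto (fun z => Real.exp (-(K * Real.exp (-z))) / K) atTop (𝓝 (1 / K)) := by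
    have h1 : Tendsto (fun z => -(K * Real.exp (-z))) atTop (𝓝 0) := by
      simpa using (Real.tendsto_exp_neg_atTop_nhds_zero.const_mul K).neg
    have h2 := (Real.continuous_exp.tendsto 0).comp h1
    rw [Real.exp_zero] at h2
    exact h2.div_const K
  have h3 := integrableOn_Ioi_deriv_of_nonneg' (a := t)
    (fun z _ => hasDerivAt_exp_neg_mul_exp hK z) (fun z _ => by positivity) hlim
  have h4 := integral_Ioi_of_hasDerivAt_of_nonneg' (a := t)
    (fun z _ => hasDerivAt_exp_neg_mul_exp hK z) (fun z _ => by positivity) hlim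
  rw [← ofReal_integral_eq_lintegral_ofReal h3 (ae_of_all _ fun z => by positivity), h4]

theorem lintegral_gumbel {K : ℝ} (hK : 0 < K) :
    ∫⁻ z, ENNReal.ofReal (Real.exp (-z) * Real.exp (-(K * Real.exp (-z)))) =
      ENNReal.ofReal (1 / K) := by
  rw [← lintegral_add_compl _ (measurableSet_Iic (a := (0 : ℝ))), compl_Iic,
    ← setLIntegral_congr Iio_ae_eq_Iic, setLIntegral_Iio_gumbel hK, setLIntegral_Ioi_gumbel hK,
    ← ENNReal.ofReal_add (by positivity)]
  · congr 1; ring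
  · rw [← sub_div]
    refine div_nonneg (sub_nonneg.2 (Real.exp_le_one_iff.2 ?_)) hK.le
    have : 0 ≤ K * Real.exp (-0) := by positivity
    linarith

theorem gumbel_eq :
    gumbel = volume.withDensity fun z : ℝ =>
      ENNReal.ofReal (Real.exp (-z) * Real.exp (-(1 * Real.exp (-z)))) := by
  unfold gumbel
  congr 1
  funext z
  rw [← Real.exp_add]
  congr 2
  ring

theorem gumbel_Iio (t : ℝ) :
    gumbel (Iio t) = ENNReal.ofReal (Real.exp (-Real.exp (-t))) := by
  rw [gumbel_eq, withDensity_apply _ measurableSet_Iio, setLIntegral_Iio_gumbel one_pos]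
  simp

instance isProbabilityMeasure_gumbel : IsProbabilityMeasure gumbel := by
  refine ⟨?_⟩
  rw [gumbel_eq, withDensity_apply _ MeasurableSet.univ, Measure.restrict_univ,
    lintegral_gumbel one_pos]
  simp

theorem lintegral_exp_gumbel {K : ℝ} (hK : 0 ≤ K) :
    ∫⁻ t, ENNReal.ofReal (Real.exp (-(K * Real.exp (-t)))) ∂gumbel =
      ENNReal.ofReal (1 / (1 + K)) := by
  rw [gumbel_eq, lintegral_withDensity_eq_lintegral_mul _ (by fun_prop) (by fun_prop),
    ← lintegral_gumbel (by positivity)]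
  refine lintegral_congr fun t => ?_
  rw [Pi.mul_apply, ← ENNReal.ofReal_mul (by positivity), mul_assoc, ← Real.exp_add]
  congr 3
  ring

/-- The event that `c` has the greatest noisy score among the indices in `I`. -/
def argmaxEvent {N : ℕ} (w : Fin N → ℝ) (I : Finset (Fin N)) (c : Fin N) : Set (Fin N → ℝ) :=
  {z | ∀ d ∈ I, d ≠ c → w d + z d < w c + z c}

theorem measurableSet_argmaxEvent {N : ℕ} (w : Fin N → ℝ) (I : Finset (Fin N)) (c : Fin N) :
    MeasurableSet (argmaxEvent w I c) := by
  unfold argmaxEvent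
  simp only [ofPred_forall]
  refine MeasurableSet.iInter fun d => MeasurableSet.iInter fun _ => MeasurableSet.iInter fun _ =>
    measurableSet_lt (by fun_prop) (by fun_prop)

theorem disjoint_argmaxEvent {N : ℕ} (w : Fin N → ℝ) {I : Finset (Fin N)} {c d : Fin N}
    (hc : c ∈ I) (hd : d ∈ I) (hcd : c ≠ d) :
    Disjoint (argmaxEvent w I c) (argmaxEvent w I d) := by
  rw [Set.disjoint_left]
  intro z h1 h2
  exact lt_asymm (h1 d hd hcd.symm) (h2 c hc hcd)

/-- The Gumbel-max trick. -/
theorem pi_gumbel_argmaxEvent {N : ℕ} (w : Fin N → ℝ) {I : Finset (Fin N)} {c : Fin N}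
    (hc : c ∈ I) :
    (Measure.pi fun _ : Fin N => gumbel) (argmaxEvent w I c) =
      ENNReal.ofReal (Real.exp (w c) / ∑ d ∈ I, Real.exp (w d)) := by
  obtain ⟨k, rfl⟩ : ∃ k, N = k + 1 := ⟨N - 1, by have := c.2; omega⟩
  classical
  set K := ∑ j : Fin k, if c.succAbove j ∈ I then Real.exp (w (c.succAbove j) - w c) else 0
    with hK
  have hK0 : 0 ≤ K := Finset.sum_nonneg fun j _ => by split_ifs <;> positivity
  set E' : Set (ℝ × (Fin k → ℝ)) :=
    {p | ∀ j, c.succAbove j ∈ I → w (c.succAbove j) + p.2 j < w c + p.1} with hE'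
  have hmeas : MeasurableSet E' := by
    simp only [hE', ofPred_forall]
    exact MeasurableSet.iInter fun j => MeasurableSet.iInter fun _ =>
      measurableSet_lt (by fun_prop) (by fun_prop)
  have hpre : argmaxEvent w I c = MeasurableEquiv.piFinSuccAbove (fun _ => ℝ) c ⁻¹' E' := by
    ext z
    simp only [argmaxEvent, mem_ofPred_eq, hE', mem_preimage]
    rw [Fin.forall_iff_succAbove c]
    simp only [ne_eq, not_true_eq_false, false_imp_iff, implies_true, true_and,
      Fin.succAbove_ne, not_false_eq_true, true_imp_iff]
    rfl
  have hmp := measurePreserving_piFinSuccAbove (fun _ : Fin (k + 1) => gumbel) c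
  rw [hpre, hmp.measure_preimage hmeas.nullMeasurableSet, Measure.prod_apply hmeas]
  -- Given that the noise of `c` is `t`, the other coordinates are independent, and the Gumbel
  -- distribution functions multiply to one exponential with the rates added in `K`.
  have hslice : ∀ t, (Measure.pi fun _ : Fin k => gumbel) (Prod.mk t ⁻¹' E') =
      ENNReal.ofReal (Real.exp (-(K * Real.exp (-t)))) := by
    intro t
    have h1 : Prod.mk t ⁻¹' E' = Set.pi univ fun j =>
        if c.succAbove j ∈ I then Iio (w c + t - w (c.succAbove j)) else univ := by
      ext y
      simp only [hE', mem_preimage, mem_ofPred_eq, Set.mem_pi, mem_univ, true_imp_iff]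
      refine forall_congr' fun j => ?_
      split_ifs with h
      · simp only [h, true_imp_iff, mem_Iio]
        constructor <;> intro _ <;> linarith
      · simp [h]
    rw [h1, Measure.pi_pi, hK, Finset.sum_mul, ← Finset.sum_neg_distrib, Real.exp_sum,
      ENNReal.ofReal_prod_of_nonneg fun _ _ => (Real.exp_pos _).le]
    refine Finset.prod_congr rfl fun j _ => ?_
    split_ifs with h
    · rw [gumbel_Iio, ← Real.exp_add]
      congr 4
      ring
    · simp
  rw [lintegral_congr hslice, lintegral_exp_gumbel hK0]
  congr 1
  have hsum : ∑ d ∈ I, Real.exp (w d) = Real.exp (w c) * (1 + K) := by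
    have h1 : ∑ d ∈ I, Real.exp (w d) = ∑ d, if d ∈ I then Real.exp (w d) else 0 := by
      rw [Finset.sum_ite_mem, Finset.univ_inter]
    rw [h1, Fin.sum_univ_succAbove _ c, if_pos hc, hK, mul_add, mul_one, Finset.mul_sum]
    congr 1
    refine Finset.sum_congr rfl fun j _ => ?_
    split_ifs
    · rw [← Real.exp_add]
      congr 1
      ring
    · simp
  rw [hsum]
  have := Real.exp_pos (w c)
  field_simp

end Gumbel

/-! ## The output law -/

section Selection

variable {𝒳 : Type u} [LinearOrder 𝒳] [Fintype 𝒳]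

/-- The score of iteration `c` of the selection phase, without noise. -/
noncomputable def iterScore (ε α q : ℝ) (n : ℕ) (S : List (GKTuple 𝒳)) (c : ℕ) : ℝ :=
  Real.log ((cell S c).card : ℝ) + ε / (2 * (4 * α * n + 2)) *
    -distToInterval (targetRank q n) (iterMin S c) (iterMax S c)

/-- The bound on `maxValue` by any strict upper bound `B` serves the last clause: when a strict
winner is reached, everything before it is smaller, so the update happens and is never undone. -/
theorem foldl_selectStep (ε α q : ℝ) (m₀ : Memory 𝒳) (hi : m₀.i = 0) (hmax : m₀.maxValue = ⊥)
    (zs : List ℝ) :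
    let m := zs.foldl (selectStep ε α q) m₀
    m.i = zs.length ∧ m.sketch = m₀.sketch ∧ m.n = m₀.n ∧
    (∀ B : ℝ, (∀ d z, zs[d]? = some z → (cell m₀.sketch d).Nonempty →
      iterScore ε α q m₀.n m₀.sketch d + z < B) → m.maxValue < (B : WithBot ℝ)) ∧
    (∀ c y, zs[c]? = some y → (cell m₀.sketch c).Nonempty →
      (∀ d z, zs[d]? = some z → (cell m₀.sketch d).Nonempty → d ≠ c →
        iterScore ε α q m₀.n m₀.sketch d + z < iterScore ε α q m₀.n m₀.sketch c + y) →
      m.maxIndex = some c ∧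
        m.maxValue = ((iterScore ε α q m₀.n m₀.sketch c + y : ℝ) : WithBot ℝ)) := by
  induction zs using List.reverseRecOn with
  | nil => simp [hi, hmax]
  | append_singleton zs y ih =>
    obtain ⟨h1, h2, h3, h4, h5⟩ := ih
    simp only [List.foldl_append, List.foldl_cons, List.foldl_nil]
    set m := zs.foldl (selectStep ε α q) m₀ with hm
    have hlast : (zs ++ [y])[zs.length]? = some y := by simp
    have hinit : ∀ {d : ℕ} {z : ℝ}, zs[d]? = some z → (zs ++ [y])[d]? = some z := by
      intro d z h
      rw [List.getElem?_append_left (List.getElem?_eq_some_iff.1 h).1, h]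
    have hcase : ∀ {d : ℕ} {z : ℝ}, (zs ++ [y])[d]? = some z →
        (d < zs.length ∧ zs[d]? = some z) ∨ (d = zs.length ∧ z = y) := by
      intro d z h
      rcases lt_trichotomy d zs.length with hd | rfl | hd
      · rw [List.getElem?_append_left hd] at h
        exact Or.inl ⟨hd, h⟩
      · rw [hlast] at h
        exact Or.inr ⟨rfl, (Option.some.inj h).symm⟩
      · rw [List.getElem?_eq_none (by simp; omega)] at h
        exact absurd h (by simp)
    unfold selectStep
    rw [h1, h2, h3]
    split_ifs with hne
    · have hscore : Real.log ((cell m₀.sketch zs.length).card : ℝ) +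
          ε / (2 * (4 * α * m₀.n + 2)) * -distToInterval (targetRank q m₀.n)
            (iterMin m₀.sketch zs.length) (iterMax m₀.sketch zs.length) + y =
          iterScore ε α q m₀.n m₀.sketch zs.length + y := rfl
      simp only [hscore]
      refine ⟨by simp, trivial, trivial, fun B hB => ?_, fun c y' hc hcne hB => ?_⟩
      · split_ifs
        · exact WithBot.coe_lt_coe.2 (hB _ _ hlast hne)
        · exact h4 B fun d z hd => hB d z (hinit hd)
      · rcases hcase hc with ⟨hlt, hc'⟩ | ⟨rfl, rfl⟩
        · obtain ⟨h6, h7⟩ := h5 c y' hc' hcne fun d z hd => hB d z (hinit hd)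
          have h8 : ¬ m.maxValue <
              ((iterScore ε α q m₀.n m₀.sketch zs.length + y : ℝ) : WithBot ℝ) := by
            rw [h7, not_lt, WithBot.coe_le_coe]
            exact (hB _ _ hlast hne hlt.ne').le
          rw [if_neg h8, if_neg h8]
          exact ⟨h6, h7⟩
        · have h8 : m.maxValue <
              ((iterScore ε α q m₀.n m₀.sketch zs.length + y' : ℝ) : WithBot ℝ) :=
            h4 _ fun d z hd hdne => hB d z (hinit hd) hdne
              (List.getElem?_eq_some_iff.1 hd).1.ne
          rw [if_pos h8, if_pos h8]
          exact ⟨rfl, rfl⟩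
    · refine ⟨by simp, rfl, rfl, fun B hB => ?_, fun c y' hc hcne hB => ?_⟩
      · exact h4 B fun d z hd => hB d z (hinit hd)
      · rcases hcase hc with ⟨hlt, hc'⟩ | ⟨rfl, rfl⟩
        · exact h5 c y' hc' hcne fun d z hd => hB d z (hinit hd)
        · exact absurd hcne hne

variable {n : ℕ}

/-- The iterations of the selection phase that are not skipped. -/
noncomputable def activeIter (α : ℝ) (X : Fin n → 𝒳) : Finset (Fin (numIter α X)) :=
  Finset.univ.filter fun c => (cell (sketchOf α X) c).Nonempty

theorem afterStream_eq {𝒳 : Type u} [LinearOrder 𝒳] (α : ℝ) (X : Fin n → 𝒳) :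
    (afterStream α X).i = 0 ∧ (afterStream α X).maxValue = ⊥ ∧ (afterStream α X).n = n := by
  have h : ∀ xs : List 𝒳, (readAll α xs).i = 0 ∧ (readAll α xs).maxValue = ⊥ := by
    intro xs
    induction xs using List.reverseRecOn with
    | nil => exact ⟨rfl, rfl⟩
    | append_singleton xs x ih => rw [readAll_append_singleton]; exact ih
  refine ⟨(h _).1, (h _).2, ?_⟩
  have := readAll_n α (List.ofFn X)
  rwa [List.length_ofFn] at this

theorem output_of_mem_argmaxEvent [MeasurableSpace 𝒳] (ε α q : ℝ) (X : Fin n → 𝒳)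
    {c : Fin (numIter α X)} (hc : c ∈ activeIter α X) {z : Fin (numIter α X) → ℝ}
    (hz : z ∈ argmaxEvent (fun d => iterScore ε α q n (sketchOf α X) d) (activeIter α X) c) :
    output ((List.ofFn z).foldl (selectStep ε α q) (afterStream α X)) =
      ProbabilityTheory.uniformOn (cell (sketchOf α X) c : Set 𝒳) := by
  obtain ⟨hi, hmax, hn⟩ := afterStream_eq α X
  obtain ⟨-, h2, -, -, h5⟩ := foldl_selectStep ε α q (afterStream α X) hi hmax (List.ofFn z)
  have h6 := h5 c (z c) (by simp) (Finset.mem_filter.1 hc).2 (by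
    intro d y hd hdne hdc
    obtain ⟨hlt, rfl⟩ := List.getElem?_eq_some_iff.1 hd
    rw [List.length_ofFn] at hlt
    rw [List.getElem_ofFn, hn]
    exact hz ⟨d, hlt⟩ (Finset.mem_filter.2 ⟨Finset.mem_univ _, hdne⟩)
      fun h => hdc (congrArg Fin.val h))
  unfold output
  rw [h6.1, h2]
  rfl

/-- The utility of a universe element. -/
noncomputable def utility (α q : ℝ) (X : Fin n → 𝒳) (x : 𝒳) : ℝ :=
  -distToInterval (targetRank q n) (rHatMin (sketchOf α X) x) (rHatMax (sketchOf α X) x)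

/-- The summand `log |B|` of the score makes the weight of a cell the sum of the weights of its
elements. -/
theorem exp_iterScore {α : ℝ} (hα : 0 < α) (ε q : ℝ) (X : Fin n → 𝒳) {c : Fin (numIter α X)}
    (hc : c ∈ activeIter α X) :
    Real.exp (iterScore ε α q n (sketchOf α X) c) =
      ∑ x ∈ cell (sketchOf α X) c, Real.exp (ε / (2 * (4 * α * n + 2)) * utility α q X x) := by
  have hS := (rankInv_sketchOf hα X).sorted
  have hne := (Finset.mem_filter.1 hc).2
  have hcard : (0 : ℝ) < (cell (sketchOf α X) c).card := by exact_mod_cast hne.card_pos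
  rw [iterScore, Real.exp_add, Real.exp_log hcard, ← nsmul_eq_mul, ← Finset.sum_const]
  refine Finset.sum_congr rfl fun x hx => ?_
  rw [utility, iterMin_eq_rHatMin hS c.2 hx, iterMax_eq_rHatMax hS c.2 hx]

theorem sum_activeIter {α : ℝ} (hα : 0 < α) (X : Fin n → 𝒳) (f : 𝒳 → ℝ) :
    ∑ c ∈ activeIter α X, ∑ x ∈ cell (sketchOf α X) c, f x = ∑ x, f x := by
  have hS := (rankInv_sketchOf hα X).sorted
  rw [← Finset.sum_biUnion]
  · refine Finset.sum_congr ?_ fun _ _ => rfl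
    ext x
    simp only [Finset.mem_biUnion, Finset.mem_univ, iff_true]
    obtain ⟨c, hc, hx⟩ := exists_mem_cell hS x
    exact ⟨⟨c, hc⟩, Finset.mem_filter.2 ⟨Finset.mem_univ _, x, hx⟩, hx⟩
  · intro c _ d _ hcd
    refine Finset.disjoint_left.2 fun x hx hx' => hcd ?_
    exact Fin.ext (cell_index_unique hS c.2 d.2 hx hx')

variable [Nonempty 𝒳]

theorem activeIter_nonempty {α : ℝ} (hα : 0 < α) (X : Fin n → 𝒳) :
    (activeIter α X).Nonempty := by
  obtain ⟨x⟩ := ‹Nonempty 𝒳›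
  obtain ⟨c, hc, hx⟩ := exists_mem_cell (rankInv_sketchOf hα X).sorted x
  exact ⟨⟨c, hc⟩, Finset.mem_filter.2 ⟨Finset.mem_univ _, x, hx⟩⟩

variable [MeasurableSpace 𝒳]

theorem dpExpGKGumb_apply {α : ℝ} (hα : 0 < α) (ε q : ℝ) (X : Fin n → 𝒳) {A : Set 𝒳}
    (hA : MeasurableSet A) :
    dpExpGKGumb ε α q X A = ∑ c ∈ activeIter α X,
      ENNReal.ofReal (Real.exp (iterScore ε α q n (sketchOf α X) c) /
        ∑ d ∈ activeIter α X, Real.exp (iterScore ε α q n (sketchOf α X) d)) *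
      ProbabilityTheory.uniformOn (cell (sketchOf α X) c : Set 𝒳) A := by
  set I := activeIter α X with hI
  set w : Fin (numIter α X) → ℝ := fun d => iterScore ε α q n (sketchOf α X) d with hw
  set P := Measure.pi fun _ : Fin (numIter α X) => gumbel with hP
  set U : Fin (numIter α X) → Measure 𝒳 := fun c =>
    ProbabilityTheory.uniformOn (cell (sketchOf α X) c : Set 𝒳) with hU
  have hZ : 0 < ∑ d ∈ I, Real.exp (w d) :=
    Finset.sum_pos (fun _ _ => Real.exp_pos _) (activeIter_nonempty hα X)
  have hPE : ∀ c ∈ I, P (argmaxEvent w I c) =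
      ENNReal.ofReal (Real.exp (w c) / ∑ d ∈ I, Real.exp (w d)) :=
    fun c hc => pi_gumbel_argmaxEvent w hc
  -- The winning probabilities add up to 1, so ties have probability 0 without a separate argument.
  have hfull : P (⋃ c ∈ I, argmaxEvent w I c) = 1 := by
    rw [measure_biUnion_finset (fun c hc d hd hcd => disjoint_argmaxEvent w hc hd hcd)
      fun c _ => measurableSet_argmaxEvent w I c, Finset.sum_congr rfl hPE,
      ← ENNReal.ofReal_sum_of_nonneg fun c _ => by positivity, ← Finset.sum_div,
      div_self hZ.ne', ENNReal.ofReal_one]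
  have hae : ∀ᵐ z ∂P, z ∈ ⋃ c ∈ I, argmaxEvent w I c := by
    have hmeas : MeasurableSet (⋃ c ∈ I, argmaxEvent w I c) :=
      Finset.measurableSet_biUnion _ fun c _ => measurableSet_argmaxEvent w I c
    exact (mem_ae_iff_prob_eq_one hmeas).2 hfull
  -- A finite combination of indicators of winning events. It agrees almost everywhere with the
  -- actual output kernel, which supplies the almost everywhere measurability that
  -- `Measure.bind_apply` needs.
  set F : (Fin (numIter α X) → ℝ) → Measure 𝒳 := fun z =>
    ∑ c ∈ I, (argmaxEvent w I c).indicator (fun _ => U c) z with hF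
  have hFA : ∀ (B : Set 𝒳) z, F z B =
      ∑ c ∈ I, (argmaxEvent w I c).indicator (fun _ => U c B) z := by
    intro B z
    rw [hF, Measure.finsetSum_apply]
    refine Finset.sum_congr rfl fun c _ => ?_
    by_cases hz : z ∈ argmaxEvent w I c <;> simp [hz]
  have hFmeas : Measurable F := by
    refine Measure.measurable_of_measurable_coe _ fun B _ => ?_
    simp only [hFA]
    exact Finset.measurable_sum _ fun c _ =>
      measurable_const.indicator (measurableSet_argmaxEvent w I c)
  have heq : (fun z => output ((List.ofFn z).foldl (selectStep ε α q) (afterStream α X)))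
      =ᵐ[P] F := by
    filter_upwards [hae] with z hz
    simp only [Set.mem_iUnion] at hz
    obtain ⟨c, hc, hz⟩ := hz
    rw [output_of_mem_argmaxEvent ε α q X hc hz]
    simp only [hF]
    rw [Finset.sum_eq_single_of_mem c hc]
    · rw [Set.indicator_of_mem hz]
    · intro d hd hdc
      exact Set.indicator_of_notMem
        (Set.disjoint_left.1 (disjoint_argmaxEvent w hc hd hdc.symm) hz) _
  rw [dpExpGKGumb, Measure.bind_apply hA ⟨F, hFmeas, heq⟩]
  have heq' : (fun z => output ((List.ofFn z).foldl (selectStep ε α q) (afterStream α X)) A)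
      =ᵐ[P] fun z => F z A := heq.mono fun z hz => by simp only [hz]
  rw [lintegral_congr_ae heq']
  simp only [hFA]
  rw [lintegral_finsetSum _ fun c _ =>
    measurable_const.indicator (measurableSet_argmaxEvent w I c)]
  refine Finset.sum_congr rfl fun c hc => ?_
  rw [lintegral_indicator_const (measurableSet_argmaxEvent w I c), hPE c hc, mul_comm]

variable [MeasurableSingletonClass 𝒳]

/-- The algorithm implements the exponential mechanism on the universe. -/
theorem dpExpGKGumb_singleton {α : ℝ} (hα : 0 < α) (ε q : ℝ) (X : Fin n → 𝒳) (x : 𝒳) :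
    dpExpGKGumb ε α q X {x} = ENNReal.ofReal
      (Real.exp (ε / (2 * (4 * α * n + 2)) * utility α q X x) /
        ∑ y, Real.exp (ε / (2 * (4 * α * n + 2)) * utility α q X y)) := by
  have hS := (rankInv_sketchOf hα X).sorted
  obtain ⟨c, hc, hx⟩ := exists_mem_cell hS x
  have hcI : (⟨c, hc⟩ : Fin (numIter α X)) ∈ activeIter α X :=
    Finset.mem_filter.2 ⟨Finset.mem_univ _, x, hx⟩
  rw [dpExpGKGumb_apply hα ε q X (measurableSet_singleton x),
    Finset.sum_congr rfl fun d hd => exp_iterScore hα ε q X hd, sum_activeIter hα X,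
    Finset.sum_eq_single_of_mem _ hcI]
  · have hcard : (0 : ℝ) < (cell (sketchOf α X) c).card := by
      exact_mod_cast Finset.card_pos.2 ⟨x, hx⟩
    have h1 : ProbabilityTheory.uniformOn (cell (sketchOf α X) c : Set 𝒳) {x} =
        ENNReal.ofReal (1 / (cell (sketchOf α X) c).card) := by
      rw [ProbabilityTheory.uniformOn, ProbabilityTheory.cond_apply
        (Finset.measurableSet _), Set.inter_eq_self_of_subset_right
        (Set.singleton_subset_iff.2 hx), Measure.count_apply_finset, Measure.count_singleton,
        mul_one, one_div, ENNReal.ofReal_inv_of_pos hcard, ENNReal.ofReal_natCast]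
    rw [h1, ← ENNReal.ofReal_mul (by positivity)]
    congr 1
    have h2 : iterScore ε α q n (sketchOf α X) c = Real.log ((cell (sketchOf α X) c).card : ℝ) +
        ε / (2 * (4 * α * n + 2)) * utility α q X x := by
      rw [iterScore, utility, iterMin_eq_rHatMin hS hc hx, iterMax_eq_rHatMax hS hc hx]
    simp only
    rw [h2, Real.exp_add, Real.exp_log hcard]
    field_simp
  · intro d hd hdc
    have h1 : ProbabilityTheory.uniformOn (cell (sketchOf α X) d : Set 𝒳) {x} = 0 := by
      rw [ProbabilityTheory.uniformOn, ProbabilityTheory.cond_apply (Finset.measurableSet _)]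
      have : (cell (sketchOf α X) d : Set 𝒳) ∩ {x} = ∅ := by
        rw [Set.inter_singleton_eq_empty]
        exact fun hx' => hdc (Fin.ext (cell_index_unique hS d.2 hc hx' hx))
      rw [this, measure_empty, mul_zero]
    rw [h1, mul_zero]

end Selection

section Privacy

variable {𝒳 : Type u} [LinearOrder 𝒳] {n : ℕ}

/-! ## Privacy -/

/-- Passing from an estimate to a true rank, to the neighbour's rank and to its estimate costs only
`⌊2αn⌋ + 1` at each endpoint, because each estimate errs on one known side. The stated sensitivity
is twice that. -/
theorem utility_le_of_neighboring {α : ℝ} (hα : 0 < α) (q : ℝ) {X X' : Fin n → 𝒳}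
    (h : Neighboring X X') (x : 𝒳) :
    utility α q X x ≤ utility α q X' x + (4 * α * n + 2) ∧
      utility α q X' x ≤ utility α q X x + (4 * α * n + 2) := by
  have hfl : (⌊2 * α * (n : ℝ)⌋₊ : ℝ) ≤ 2 * α * n := Nat.floor_le (by positivity)
  have key : ∀ Y Y' : Fin n → 𝒳, rankMin Y x ≤ rankMin Y' x + 1 →
      rankMax Y' x ≤ rankMax Y x + 1 → utility α q Y' x ≤ utility α q Y x + (4 * α * n + 2) := by
    intro Y Y' h1 h2
    have h3 : rHatMin (sketchOf α Y) x ≤ rHatMin (sketchOf α Y') x + (⌊2 * α * (n : ℝ)⌋₊ + 1) := by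
      have := rHatMin_le_rankMin hα Y x
      have := rankMin_le_rHatMin_add hα Y' x
      omega
    have h4 : rHatMax (sketchOf α Y') x ≤ rHatMax (sketchOf α Y) x + (⌊2 * α * (n : ℝ)⌋₊ + 1) := by
      have := rankMax_lt_rHatMax hα Y x
      have := rHatMax_le_rankMax_add hα Y' x
      omega
    have h5 : (rHatMin (sketchOf α Y) x : ℝ) ≤
        rHatMin (sketchOf α Y') x + ((⌊2 * α * (n : ℝ)⌋₊ : ℝ) + 1) := by exact_mod_cast h3
    have h6 : (rHatMax (sketchOf α Y') x : ℝ) ≤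
        rHatMax (sketchOf α Y) x + ((⌊2 * α * (n : ℝ)⌋₊ : ℝ) + 1) := by exact_mod_cast h4
    have h7 := distToInterval_le_add (r := targetRank q n) (rHatMin_le_rHatMax hα Y x)
      (rHatMin_le_rHatMax hα Y' x) h5 h6 (by positivity)
    have h8 : 0 ≤ α * n := by positivity
    unfold utility
    linarith
  obtain ⟨h1, h2⟩ := card_filter_le_of_neighboring h (· < x)
  obtain ⟨h3, h4⟩ := card_filter_le_of_neighboring h (· ≤ x)
  exact ⟨key X' X h2 h3, key X X' h1 h4⟩

/-- The exponential mechanism for scores that differ by at most `δ / 2`. -/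
theorem exp_div_sum_exp_le {ι : Type*} [Fintype ι] [Nonempty ι] {f f' : ι → ℝ} {δ : ℝ}
    (h : ∀ y, f y ≤ f' y + δ / 2 ∧ f' y ≤ f y + δ / 2) (x : ι) :
    Real.exp (f x) / ∑ y, Real.exp (f y) ≤
      Real.exp δ * (Real.exp (f' x) / ∑ y, Real.exp (f' y)) := by
  have hZ : 0 < ∑ y, Real.exp (f y) :=
    Finset.sum_pos (fun _ _ => Real.exp_pos _) Finset.univ_nonempty
  have hZ' : 0 < ∑ y, Real.exp (f' y) :=
    Finset.sum_pos (fun _ _ => Real.exp_pos _) Finset.univ_nonempty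
  have h1 : Real.exp (f x) ≤ Real.exp (δ / 2) * Real.exp (f' x) := by
    rw [← Real.exp_add]
    exact Real.exp_le_exp.2 (by linarith [(h x).1])
  have h2 : ∑ y, Real.exp (f' y) ≤ Real.exp (δ / 2) * ∑ y, Real.exp (f y) := by
    rw [Finset.mul_sum]
    refine Finset.sum_le_sum fun y _ => ?_
    rw [← Real.exp_add]
    exact Real.exp_le_exp.2 (by linarith [(h y).2])
  have h3 : Real.exp δ = Real.exp (δ / 2) * Real.exp (δ / 2) := by
    rw [← Real.exp_add, add_halves]
  rw [h3, ← mul_div_assoc, div_le_div_iff₀ hZ hZ']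
  calc _ ≤ Real.exp (δ / 2) * Real.exp (f' x) * (Real.exp (δ / 2) * ∑ y, Real.exp (f y)) :=
        mul_le_mul h1 h2 hZ'.le (by positivity)
    _ = _ := by ring

variable [Fintype 𝒳] [Nonempty 𝒳] [MeasurableSpace 𝒳] [MeasurableSingletonClass 𝒳]

theorem dpExpGKGumb_finset {α : ℝ} (hα : 0 < α) (ε q : ℝ) (X : Fin n → 𝒳) (A : Finset 𝒳) :
    dpExpGKGumb ε α q X A = ENNReal.ofReal
      (∑ x ∈ A, Real.exp (ε / (2 * (4 * α * n + 2)) * utility α q X x) /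
        ∑ y, Real.exp (ε / (2 * (4 * α * n + 2)) * utility α q X y)) := by
  rw [← sum_measure_singleton, ENNReal.ofReal_sum_of_nonneg fun x _ => by positivity]
  exact Finset.sum_congr rfl fun x _ => dpExpGKGumb_singleton hα ε q X x

theorem isProbabilityMeasure_dpExpGKGumb {α : ℝ} (hα : 0 < α) (ε q : ℝ) (X : Fin n → 𝒳) :
    IsProbabilityMeasure (dpExpGKGumb ε α q X) := by
  refine ⟨?_⟩
  rw [← Finset.coe_univ, dpExpGKGumb_finset hα, ← Finset.sum_div, div_self, ENNReal.ofReal_one]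
  exact (Finset.sum_pos (fun _ _ => Real.exp_pos _) Finset.univ_nonempty).ne'

theorem isDifferentiallyPrivate_dpExpGKGumb {α : ℝ} (hα : 0 < α) {ε : ℝ} (hε : 0 < ε) (q : ℝ) :
    IsDifferentiallyPrivate ε (fun X : Fin n → 𝒳 => dpExpGKGumb ε α q X) := by
  classical
  intro X X' h A _
  have hA : A = (A.toFinset : Set 𝒳) := by simp
  rw [hA, dpExpGKGumb_finset hα, dpExpGKGumb_finset hα, ← ENNReal.ofReal_mul (by positivity)]
  refine ENNReal.ofReal_le_ofReal ?_
  rw [Finset.mul_sum]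
  refine Finset.sum_le_sum fun x _ => exp_div_sum_exp_le
    (f := fun y => ε / (2 * (4 * α * n + 2)) * utility α q X y)
    (f' := fun y => ε / (2 * (4 * α * n + 2)) * utility α q X' y) (fun y => ?_) x
  have hD : 0 < 4 * α * n + 2 := by positivity
  have hκ : ε / (2 * (4 * α * n + 2)) * (4 * α * n + 2) = ε / 2 := by field_simp
  have hκ0 : 0 ≤ ε / (2 * (4 * α * n + 2)) := by positivity
  obtain ⟨h1, h2⟩ := utility_le_of_neighboring hα q h y
  rw [← hκ, ← mul_add, ← mul_add]
  exact ⟨mul_le_mul_of_nonneg_left h1 hκ0, mul_le_mul_of_nonneg_left h2 hκ0⟩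

end Privacy

/-! ## Accuracy -/

section Accuracy

variable {𝒳 : Type u} [LinearOrder 𝒳] [Fintype 𝒳] [Nonempty 𝒳] {n : ℕ}

/-- Take the least `x` with `rankMax X x ≥ r`. If `rankMin X x` exceeded `r`, the largest stream
element below `x` would already have `rankMax` greater than `r`. -/
theorem exists_rank_interval {r : ℕ} (hr : r ≤ n) (X : Fin n → 𝒳) :
    ∃ x, rankMin X x ≤ r ∧ r ≤ rankMax X x := by
  classical
  have hne : (Finset.univ.filter fun x : 𝒳 => r ≤ rankMax X x).Nonempty := by
    refine ⟨Finset.univ.max' Finset.univ_nonempty, Finset.mem_filter.2 ⟨Finset.mem_univ _, ?_⟩⟩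
    have h1 : (Finset.univ.filter fun i => X i ≤ Finset.univ.max' Finset.univ_nonempty) =
        Finset.univ :=
      Finset.filter_true_of_mem fun i _ => Finset.le_max' _ _ (Finset.mem_univ _)
    rw [rankMax, h1, Finset.card_univ, Fintype.card_fin]
    exact hr
  set x := Finset.min' _ hne with hx
  refine ⟨x, ?_, (Finset.mem_filter.1 (Finset.min'_mem _ hne)).2⟩
  by_contra hcon
  have hlt : 0 < rankMin X x := by omega
  have hI : ((Finset.univ.filter fun i => X i < x).image X).Nonempty :=
    (Finset.card_pos.1 hlt).image X
  obtain ⟨i, hi, hiy⟩ := Finset.mem_image.1 (Finset.max'_mem _ hI)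
  set y := Finset.max' _ hI with hy
  have hyx : y < x := hiy ▸ (Finset.mem_filter.1 hi).2
  have h1 : rankMin X x ≤ rankMax X y := by
    refine Finset.card_le_card fun j hj => Finset.mem_filter.2 ⟨Finset.mem_univ _, ?_⟩
    exact Finset.le_max' _ _ (Finset.mem_image_of_mem X hj)
  have h2 : x ≤ y := Finset.min'_le _ _ (Finset.mem_filter.2 ⟨Finset.mem_univ _, by omega⟩)
  exact absurd hyx (not_lt.2 h2)

theorem exists_utility_eq_zero {α : ℝ} (hα : 0 < α) {q : ℝ} (hq : q ∈ Set.Icc (0 : ℝ) 1)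
    (X : Fin n → 𝒳) : ∃ x, utility α q X x = 0 := by
  have h0 : 0 ≤ ⌈q * (n : ℝ)⌉ := Int.ceil_nonneg (mul_nonneg hq.1 (Nat.cast_nonneg n))
  have h1 : ⌈q * (n : ℝ)⌉ ≤ n := by
    rw [Int.ceil_le]
    push_cast
    exact mul_le_of_le_one_left (Nat.cast_nonneg n) hq.2
  obtain ⟨r, hr⟩ := Int.eq_ofNat_of_zero_le h0
  rw [hr] at h1
  obtain ⟨x, h2, h3⟩ := exists_rank_interval (r := r) (by exact_mod_cast h1) X
  refine ⟨x, ?_⟩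
  have h4 : targetRank q n = r := by rw [targetRank, hr]; simp
  have h5 : (rHatMin (sketchOf α X) x : ℝ) ≤ r := by
    exact_mod_cast (rHatMin_le_rankMin hα X x).trans h2
  have h6 : (r : ℝ) ≤ rHatMax (sketchOf α X) x := by
    have := rankMax_lt_rHatMax hα X x
    exact_mod_cast (show r ≤ rHatMax (sketchOf α X) x by omega)
  rw [utility, h4, distToInterval_eq _ (rHatMin_le_rHatMax hα X x), max_eq_left, neg_zero]
  exact max_le (by linarith) (by linarith)

variable [MeasurableSpace 𝒳] [MeasurableSingletonClass 𝒳]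

/-- An element of utility 0 makes the normalising sum at least 1, so each element at distance more
than `T` has probability at most `exp (-κT) ≤ β / |𝒳|`. -/
theorem le_dpExpGKGumb_real {α : ℝ} (hα : 0 < α) {ε : ℝ} (hε : 0 < ε) {q : ℝ}
    (hq : q ∈ Set.Icc (0 : ℝ) 1) (X : Fin n → 𝒳) {β T : ℝ} (hβ : 0 < β)
    (hT : 2 * (4 * α * n + 2) * Real.log (Fintype.card 𝒳 / β) / ε ≤ T) :
    1 - β ≤ (dpExpGKGumb ε α q X).real
      {x | distToInterval (targetRank q n) (rHatMin (sketchOf α X) x)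
        (rHatMax (sketchOf α X) x) ≤ T} := by
  classical
  have := isProbabilityMeasure_dpExpGKGumb hα ε q X
  set κ := ε / (2 * (4 * α * n + 2)) with hκ
  have hD : 0 < 4 * α * n + 2 := by positivity
  have hκ0 : 0 < κ := by positivity
  set G := {x | distToInterval (targetRank q n) (rHatMin (sketchOf α X) x)
        (rHatMax (sketchOf α X) x) ≤ T} with hG
  have hcompl := probReal_compl_eq_one_sub (μ := dpExpGKGumb ε α q X) (s := G)
    (Set.toFinite G).measurableSet
  have hZ : 1 ≤ ∑ y, Real.exp (κ * utility α q X y) := by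
    obtain ⟨x, hx⟩ := exists_utility_eq_zero hα hq X
    have h1 := Finset.single_le_sum (f := fun y => Real.exp (κ * utility α q X y))
      (fun _ _ => (Real.exp_pos _).le) (Finset.mem_univ x)
    simpa [hx] using h1
  have hcard : (0 : ℝ) < Fintype.card 𝒳 := by exact_mod_cast Fintype.card_pos
  have hκT : Real.log (Fintype.card 𝒳 / β) ≤ κ * T := by
    have h1 : Real.log (Fintype.card 𝒳 / β) =
        κ * (2 * (4 * α * n + 2) * Real.log (Fintype.card 𝒳 / β) / ε) := by
      rw [hκ]; field_simp
    rw [h1]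
    exact mul_le_mul_of_nonneg_left hT hκ0.le
  have hexp : Real.exp (-(κ * T)) ≤ β / Fintype.card 𝒳 := by
    rw [← Real.exp_log (show (0 : ℝ) < β / Fintype.card 𝒳 by positivity)]
    refine Real.exp_le_exp.2 ?_
    have : Real.log (β / Fintype.card 𝒳) = -Real.log (Fintype.card 𝒳 / β) := by
      rw [← Real.log_inv, inv_div]
    linarith
  have hbad : (dpExpGKGumb ε α q X).real Gᶜ ≤ β := by
    have hA : Gᶜ = (Gᶜ.toFinset : Set 𝒳) := (Set.coe_toFinset _).symm
    rw [hA, Measure.real, dpExpGKGumb_finset hα, ENNReal.toReal_ofReal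
      (Finset.sum_nonneg fun _ _ => div_nonneg (Real.exp_pos _).le
        (Finset.sum_nonneg fun _ _ => (Real.exp_pos _).le))]
    have h1 : ∀ x ∈ Gᶜ.toFinset, Real.exp (κ * utility α q X x) /
        ∑ y, Real.exp (κ * utility α q X y) ≤ β / Fintype.card 𝒳 := by
      intro x hx
      have hx' : T < distToInterval (targetRank q n) (rHatMin (sketchOf α X) x)
        (rHatMax (sketchOf α X) x) := not_le.1 (Set.mem_toFinset.1 hx)
      refine (div_le_self (Real.exp_pos _).le hZ).trans (le_trans (Real.exp_le_exp.2 ?_) hexp)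
      rw [← mul_neg]
      exact mul_le_mul_of_nonneg_left (by unfold utility; linarith) hκ0.le
    refine (Finset.sum_le_card_nsmul _ _ _ h1).trans ?_
    rw [nsmul_eq_mul]
    have h2 : ((Gᶜ.toFinset).card : ℝ) ≤ Fintype.card 𝒳 := by
      exact_mod_cast Finset.card_le_univ _
    calc _ ≤ (Fintype.card 𝒳 : ℝ) * (β / Fintype.card 𝒳) := by gcongr
      _ = β := by field_simp
  linarith

end Accuracy

/-- Closeness to the estimated rank interval implies closeness to the true one. -/
theorem isApproxQuantile_of_distToInterval_le {𝒳 : Type u} [LinearOrder 𝒳] {n : ℕ}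
    {a : ℝ} (ha : 0 < a) {α q T : ℝ} {X : Fin n → 𝒳}
    {x : 𝒳} (hα : 1 ≤ α * n) (hT : T + 2 * a * n ≤ α * n / 2)
    (h : distToInterval (targetRank q n) (rHatMin (sketchOf a X) x)
        (rHatMax (sketchOf a X) x) ≤ T) : IsApproxQuantile α q X x := by
  have hfl : (⌊2 * a * (n : ℝ)⌋₊ : ℝ) ≤ 2 * a * n := Nat.floor_le (by positivity)
  rw [distToInterval_eq _ (rHatMin_le_rHatMax ha X x), max_le_iff, max_le_iff] at h
  obtain ⟨-, h1, h2⟩ := h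
  have h3 : (rankMin X x : ℝ) ≤ rHatMin (sketchOf a X) x + (⌊2 * a * (n : ℝ)⌋₊ : ℝ) := by
    exact_mod_cast rankMin_le_rHatMin_add ha X x
  have h4 : (rHatMax (sketchOf a X) x : ℝ) ≤ rankMax X x + (⌊2 * a * (n : ℝ)⌋₊ : ℝ) + 1 := by
    exact_mod_cast rHatMax_le_rankMax_add ha X x
  have h5 : (rankMin X x : ℝ) ≤ rankMax X x := by exact_mod_cast rankMin_le_rankMax X x
  -- The shift by 1 in `rHatMax` leaves only the bound `αn/2 + 1`. This suffices if `αn ≥ 2`.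
  -- Otherwise the difference is below 2, and being an integer it is at most `1 ≤ αn`.
  have h6 : targetRank q n - rankMax X x ≤ α * n := by
    by_contra hcon
    rw [not_le] at hcon
    have h7 : targetRank q n - rankMax X x < 2 ∨ 2 ≤ α * n := by
      by_contra! h8
      linarith
    rcases h7 with h7 | h7
    · have h8 : ((⌈q * (n : ℝ)⌉ - rankMax X x : ℤ) : ℝ) < (2 : ℤ) := by
        push_cast; exact h7
      have h9 : ((1 : ℤ) : ℝ) < ((⌈q * (n : ℝ)⌉ - rankMax X x : ℤ) : ℝ) := by
        push_cast; exact hα.trans_lt hcon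
      have h10 := Int.cast_lt.1 h8
      have h11 := Int.cast_lt.1 h9
      omega
    · linarith
  rw [IsApproxQuantile, Set.Icc_inter_Icc, Set.nonempty_Icc]
  exact max_le (le_min h5 (by linarith)) (le_min (by linarith) (by linarith))

/-! ## Space -/

section SpaceUsage

variable {𝒳 : Type u} [LinearOrder 𝒳] [Fintype 𝒳] {n : ℕ}

theorem exists_prefix_of_mem_scanl {ι κ : Type*} {f : κ → ι → κ} {l : List ι} {b m : κ}
    (h : m ∈ l.scanl f b) : ∃ l', l' <+: l ∧ m = l'.foldl f b := by
  induction l generalizing b with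
  | nil => exact ⟨[], List.prefix_rfl, by simpa using h⟩
  | cons a l ih =>
    rw [List.scanl_cons, List.mem_cons] at h
    rcases h with rfl | h
    · exact ⟨[], List.nil_prefix, rfl⟩
    · obtain ⟨l', h1, h2⟩ := ih h
      exact ⟨a :: l', List.cons_prefix_cons.2 ⟨rfl, h1⟩, h2⟩

theorem sketch_foldl_selectStep (ε α q : ℝ) (m : Memory 𝒳) (zs : List ℝ) :
    (zs.foldl (selectStep ε α q) m).sketch = m.sketch := by
  induction zs generalizing m with
  | nil => rfl
  | cons z zs ih =>
    rw [List.foldl_cons, ih]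
    unfold selectStep
    split_ifs <;> rfl

theorem usesSpaceAtMost (ε q : ℝ) {α : ℝ} (hα : 0 < α) (hα1 : α ≤ 1) (X : Fin n → 𝒳) :
    UsesSpaceAtMost ε α q X (200 * (1 / α * max 1 (Real.log (α * n)))) := by
  intro z m hm
  -- Every memory content holds the sketch of a prefix of the stream, as selection leaves the sketch
  -- alone. Three words for each of `60W/α` tuples plus 16 stay below `200W/α`, where `W` is the
  -- maximum of 1 and the logarithm.
  have key : ∃ xs : List 𝒳, xs.length ≤ n ∧ m.sketch = (readAll α xs).sketch := by
    rcases List.mem_append.1 hm with hm | hm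
    · obtain ⟨xs, h1, rfl⟩ := exists_prefix_of_mem_scanl hm
      exact ⟨xs, by simpa using h1.length_le, rfl⟩
    · obtain ⟨zs, -, rfl⟩ := exists_prefix_of_mem_scanl hm
      exact ⟨List.ofFn X, by simp, sketch_foldl_selectStep _ _ _ _ _⟩
  obtain ⟨xs, hlen, hsk⟩ := key
  have h1 := length_sketch_le_log hα hα1 xs
  have h2 : max 1 (Real.log (α * xs.length)) ≤ max 1 (Real.log (α * n)) := by
    refine max_le (le_max_left _ _) ?_
    rcases Nat.eq_zero_or_pos xs.length with h0 | h0
    · rw [h0]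
      simp
    · refine le_max_of_le_right (Real.log_le_log ?_ ?_)
      · have : (0 : ℝ) < xs.length := by exact_mod_cast h0
        positivity
      · have : (xs.length : ℝ) ≤ n := by exact_mod_cast hlen
        gcongr
  have h3 : 1 / α * max 1 (Real.log (α * xs.length)) ≤ 1 / α * max 1 (Real.log (α * n)) := by
    gcongr
  have h4 : (1 : ℝ) ≤ 1 / α := by rw [le_div_iff₀ hα]; linarith
  have h5 : (1 : ℝ) ≤ 1 / α * max 1 (Real.log (α * n)) :=
    h4.trans (le_mul_of_one_le_right (by positivity) (le_max_left _ _))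
  rw [Memory.words, hsk]
  push_cast
  linarith

theorem UsesSpaceAtMost.mono {ε α q : ℝ} {X : Fin n → 𝒳} {B B' : ℝ} (hB : B ≤ B')
    (h : UsesSpaceAtMost ε α q X B) : UsesSpaceAtMost ε α q X B' :=
  fun z m hm => (h z m hm).trans hB

end SpaceUsage

end DPQuantile

/-! ### The main theorem and the choice of constants -/

theorem mainTheorem1 :
    ∃ C : ℝ, 0 < C ∧
      ∀ (𝒳 : Type*) [LinearOrder 𝒳] [Fintype 𝒳] [Nonempty 𝒳]
        [MeasurableSpace 𝒳] [MeasurableSingletonClass 𝒳] (ε : ℝ), 0 < ε →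
      -- privacy
      (∀ (α q : ℝ) (n : ℕ), 0 < α → q ∈ Set.Icc (0 : ℝ) 1 →
        (∀ X : Fin n → 𝒳,
          MeasureTheory.IsProbabilityMeasure (DPQuantile.dpExpGKGumb ε α q X)) ∧
        DPQuantile.IsDifferentiallyPrivate ε
          (fun X : Fin n → 𝒳 => DPQuantile.dpExpGKGumb ε α q X)) ∧
      -- space and accuracy in terms of the estimated rank interval
      (∀ (α β q : ℝ) (n : ℕ) (X : Fin n → 𝒳),
        0 < α → α ≤ 1 → 0 < β → β ≤ 1 → q ∈ Set.Icc (0 : ℝ) 1 →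
        DPQuantile.UsesSpaceAtMost ε α q X (C * (1 / α * max 1 (Real.log (α * n)))) ∧
        1 - β ≤ (DPQuantile.dpExpGKGumb ε α q X).real
          {x | DPQuantile.distToInterval (DPQuantile.targetRank q n)
                (DPQuantile.rHatMin (DPQuantile.sketchOf α X) x)
                (DPQuantile.rHatMax (DPQuantile.sketchOf α X) x)
              ≤ 2 * α * n
                + 2 * (4 * α * n + 2) * Real.log (Fintype.card 𝒳 / β) / ε}) ∧
      -- space and accuracy for approximate quantiles
      (∀ (α β : ℝ), 0 < α → α ≤ 1 → 0 < β → β ≤ 1 → 2 ≤ Fintype.card 𝒳 →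
        ∃ a : ℝ, 0 < a ∧ a ≤ 1 ∧
          ∀ (q : ℝ) (n : ℕ) (X : Fin n → 𝒳), q ∈ Set.Icc (0 : ℝ) 1 →
            1 ≤ α * n → 12 * Real.log (Fintype.card 𝒳 / β) / (α * ε) < n →
            DPQuantile.UsesSpaceAtMost ε a q X
              (C * ((α * min ε 1)⁻¹ * Real.log (Fintype.card 𝒳 / β)
                * Real.log (α * ε * n))) ∧
            1 - β ≤ (DPQuantile.dpExpGKGumb ε a q X).real
              {x | DPQuantile.IsApproxQuantile α q X x}) := by
  -- The product of 200 from `usesSpaceAtMost` and 100 from the sketch parameter `a` chosen below.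
  refine ⟨20000, by norm_num, ?_⟩
  intro 𝒳 _ _ _ _ _ ε hε
  refine ⟨?_, ?_, ?_⟩
  · intro α q n hα _
    exact ⟨fun X => DPQuantile.isProbabilityMeasure_dpExpGKGumb hα ε q X,
      DPQuantile.isDifferentiallyPrivate_dpExpGKGumb hα hε q⟩
  · intro α β q n X hα hα1 hβ _ hq
    refine ⟨(DPQuantile.usesSpaceAtMost ε q hα hα1 X).mono ?_,
      DPQuantile.le_dpExpGKGumb_real hα hε hq X hβ ?_⟩
    · gcongr
      norm_num
    -- For the estimated rank interval the bound already holds without the summand `2αn`.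
    · have : 0 ≤ 2 * α * n := by positivity
      linarith
  · intro α β hα hα1 hβ hβ1 hcard
    set Λ := Real.log (Fintype.card 𝒳 / β) with hΛ
    have hΛ2 : 0.69 ≤ Λ := by
      have h1 : (2 : ℝ) ≤ Fintype.card 𝒳 / β := by
        rw [le_div_iff₀ hβ]
        have : (2 : ℝ) ≤ Fintype.card 𝒳 := by exact_mod_cast hcard
        linarith
      have h2 := Real.log_le_log two_pos h1
      have h3 := Real.log_two_gt_d9
      linarith
    set μ := min ε 1 with hμ
    have hμ0 : 0 < μ := lt_min hε one_pos
    have hμ1 : μ ≤ 1 := min_le_right _ _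
    have hμε : μ ≤ ε := min_le_left _ _
    have hΛ0 : 0 < Λ := by linarith
    -- The sketch parameter is finer than `α` by the factor `μ / (100Λ)`, so that the part of the
    -- noise error proportional to `a * n * Λ / ε` is a small multiple of `αn`.
    have ha0 : 0 < α * μ / (100 * Λ) := by positivity
    have haμ : α * μ / (100 * Λ) * (100 * Λ) = α * μ := by field_simp
    set a := α * μ / (100 * Λ) with ha
    have hαμ : α * μ ≤ 1 := mul_le_one₀ hα1 hμ0.le hμ1
    have ha1 : a ≤ 1 := by
      rw [ha, div_le_one (by positivity)]
      linarith
    refine ⟨a, ha0, ha1, ?_⟩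
    intro q n X hq hαn hn
    rw [div_lt_iff₀ (by positivity)] at hn
    have hn0 : (0 : ℝ) < n := by
      rcases Nat.eq_zero_or_pos n with h0 | h0
      · rw [h0] at hαn
        norm_num at hαn
      · exact_mod_cast h0
    have haΛ : a * n * (100 * Λ) = α * n * μ := by
      rw [show a * n * (100 * Λ) = a * (100 * Λ) * n by ring, haμ]; ring
    have han0 : 0 < a * n := by positivity
    have han : a * n * 69 ≤ α * n := by
      have h1 : a * n * 69 ≤ a * n * (100 * Λ) := by gcongr; linarith
      have h2 : α * n * μ ≤ α * n := mul_le_of_le_one_right (by positivity) hμ1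
      linarith
    refine ⟨(DPQuantile.usesSpaceAtMost ε q ha0 ha1 X).mono ?_, ?_⟩
    · have h1 : 1 / a = 100 * ((α * μ)⁻¹ * Λ) := by
        rw [ha]; field_simp
      -- From `12Λ < αεn` and `Λ ≥ 0.69`. It makes the logarithm in the space bound at least 1 and
      -- absorbs the maximum.
      have hbig : Real.exp 1 ≤ α * ε * n := by
        have := Real.exp_one_lt_d9
        linarith
      have h2 : 1 ≤ Real.log (α * ε * n) := by
        rw [Real.le_log_iff_exp_le (lt_of_lt_of_le (Real.exp_pos 1) hbig)]
        exact hbig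
      have h3 : Real.log (a * n) ≤ Real.log (α * ε * n) := by
        refine Real.log_le_log han0 ?_
        have h4 : a * n * 1 ≤ a * n * (100 * Λ) := by gcongr; linarith
        have h5 : α * n * μ ≤ α * n * ε := by gcongr
        linarith
      have h6 : max 1 (Real.log (a * n)) ≤ Real.log (α * ε * n) := max_le h2 h3
      rw [h1]
      calc 200 * (100 * ((α * μ)⁻¹ * Λ) * max 1 (Real.log (a * n)))
          ≤ 200 * (100 * ((α * μ)⁻¹ * Λ) * Real.log (α * ε * n)) := by gcongr
        _ = _ := by ring
    · have hmain := DPQuantile.le_dpExpGKGumb_real ha0 hε hq X hβ le_rfl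
      have := DPQuantile.isProbabilityMeasure_dpExpGKGumb ha0 ε q X
      refine hmain.trans (MeasureTheory.measureReal_mono fun x hx =>
        DPQuantile.isApproxQuantile_of_distToInterval_le ha0 hαn ?_ hx)
      -- The error budget: `0.08αn` from the sketch-dependent noise, `αn/3` from the constant part
      -- of the sensitivity, and `2an ≤ (2/69)αn` from the rank estimates, together below `αn/2`.
      have h1 : 2 * (4 * a * n + 2) * Λ / ε = 8 / 100 * (a * n * (100 * Λ)) / ε + 4 * Λ / ε := by
        ring
      have h2 : 8 / 100 * (a * n * (100 * Λ)) / ε ≤ 8 / 100 * (α * n) := by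
        rw [haΛ, div_le_iff₀ hε]
        have h5 : α * n * μ ≤ α * n * ε := by gcongr
        linarith
      have h3 : 4 * Λ / ε ≤ α * n / 3 := by
        rw [div_le_iff₀ hε]
        linarith
      rw [h1]
      linarith
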